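/- Let $\Bbbk$ be a field of characteristic $0$. Let $\mathcal A_+(U(3))$ be the associative algebra generated by $v(n)$, $n\ge 0$, with relations $$v(n)v(m)-3v(n-1)v(m+1)+3v(n-2)v(m+2)-v(n-3)v(m+3)=0\quad(n\ge3,\ m\ge0),$$ $$v(n)v(m)-v(m)v(n)=(n-m)v(n+m-1)\quad(n>m\ge0),$$ and let $\Lambda=\mathcal A_+(U(3))\oplus\Bbbk 1$. Let $V=\{v(1)v(0)\}\cup\{v(n)v(m): n\ge2,\ m\ge0\}$ be the set of leading words of its Gröbner–Shirshov basis $v(1)v(0)=v(0)v(1)+v(0)$, $\ v(n)v(m)=\frac{nm}{n+m-1}v(1)v(n+m-1)-\frac{(n-1)(m-1)}{n+m-1}v(0)v(n+m)+\frac{n(n-1)}{n+m-1}v(n+m-1)$ $(n\ge2,\ m\ge0)$. A word in the letters $v(n)$ is called reduced if no subword lies in $V$. *Anick chains.* A word $w=x_1\cdots x_t$ is an $n$-prechain ($n\ge1$) if there are integers $1=a_1<a_2\le b_1<a_3\le b_2<\dots<a_n\le b_{n-1}<b_n=t$ with $x_{a_j}\cdots x_{b_j}\in V$ for $1\le j\le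 n$; it is an $n$-chain if the $a_j,b_j$ can be chosen so that $x_1\cdots x_s$ is not an $m$-prechain for any $1\le m\le n$ and $s<b_m$. Let $V^{(n)}$ be the set of $n$-chains, $V^{(0)}$ the set of letters and $V^{(-1)}=\{1\}$. For nontrivial reduced words $w_1,\dots,w_n$, write $[w_1|\dots|w_n]\in V^{(n-1)}$ if $w_1\cdots w_{j+1}\in V^{(j)}$ for all $0\le j<n$. Let $A_n=\Lambda\otimes\Bbbk V^{(n-1)}$ be the free left $\Lambda$-module on these tuples. *Anick differential.* For a tuple of nontrivial reduced words put $$\delta'[w_1|\dots|w_m]=w_1[w_2|\dots|w_m]+\sum_{j=1}^{m-1}(-1)^j[w_1|\dots|s_j|\dots|w_m]\in\Lambda\otimes(\Lambda/\Bbbk)^{\otimes (m-1)},$$ where $s_j$ is the reduced form of $w_jw_{j+1}$. Let $\delta''$ be the $\Lambda$-linear operator with: $\delta''[u]=[u]$ if $[u]$ is an Anick chain; otherwise, if there is a largest $i\ge0$ such that $[u_1|\dots|u_i]\in V^{(i-1)}$ and $u_{i+1}=u'u''$ with $u',u''$ nontrivial and $[u_1|\dots|u_i|u']\in V^{(i)}$,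 then $\delta''[u]=(-1)^i\delta'[u_1|\dots|u_i|u'|u''|u_{i+2}|\dots]+[u]$; otherwise $\delta''[u]=0$. The Anick differential $\delta_{n+1}:A_{n+1}\to A_n$ is the $\Lambda$-linear map with $\delta_{n+1}(c)=(\delta'')^{m}\delta'(c)$ for every chain $c\in V^{(n)}$ and all sufficiently large $m=m(c)$. **Theorem.** The reduced words (including the empty one) form a $\Bbbk$-basis of $\Lambda$, and for every chain $c\in V^{(n)}$ $(n\ge0)$ the sequence $(\delta'')^m\delta'(c)$ is eventually constant with value in $A_n$, so the above is well defined. Write $[i_1|\dots|i_n]$ for $[v(i_1)|\dots|v(i_n)]$, to be read as $0\in A_n$ if this tuple is not an Anick chain. The basis chains of $A_{n+1}$ $(n\ge 0)$ are exactly the $[i_1|\dots|i_{n+1}]$ with $i_1,\dots,i_n\ge2$, $i_{n+1}\ge0$, and (for $n\ge1$) the $[i_1|\dots|i_{n-1}|1|0]$ with $i_1,\dots,i_{n-1}\ge2$. Put $D_j=i_j+i_{j+1}-1$. (1) If $n\ge 0$, $i_1,\dots,i_n\ge2$ and $i_{n+1}\ge0$, then $$\begin{aligned}\delta_{n+1}[i_1|\dots|i_{n+1}]={}&v(i_1)[i_2|\dots|i_{n+1}]+\sum_{j=1}^n(-1)^j\tfrac{i_ji_{j+1}}{D_j}\,v(1)[i_1|\dots|D_j|\dots|i_{n+1}]\\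 &+\sum_{j=2}^n\sum_{t=1}^{j-1}(-1)^j\tfrac{i_ji_{j+1}}{D_j}(i_t-1)[i_1|\dots|D_j|\dots|i_{n+1}]+\sum_{j=1}^n(-1)^j\tfrac{i_j(i_j-1)}{D_j}[i_1|\dots|D_j|\dots|i_{n+1}]\\ &+\sum_{j=2}^n\sum_{t=1}^{j-1}(-1)^{j+1}i_t\tfrac{(i_j-1)(i_{j+1}-1)}{D_j}[i_1|\dots|i_t-1|\dots|i_j+i_{j+1}|\dots|i_{n+1}]\\ &+\sum_{j=1}^n(-1)^{j+1}\tfrac{(i_j-1)(i_{j+1}-1)}{D_j}\,v(0)[i_1|\dots|i_j+i_{j+1}|\dots|i_{n+1}],\end{aligned}$$ where $D_j$, resp. $i_j+i_{j+1}$, replaces the two adjacent entries $i_j,i_{j+1}$. (2) If $n\ge2$ and $i_1,\dots,i_{n-1}\ge2$, then $$\begin{aligned}\delta_{n+1}[i_1|\dots|i_{n-1}|1|0]={}&v(i_1)[i_2|\dots|i_{n-1}|1|0]+\sum_{j=1}^{n-2}(-1)^j\tfrac{i_ji_{j+1}}{D_j}\,v(1)[i_1|\dots|D_j|\dots|i_{n-1}|1|0]\\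 &+\sum_{j=1}^{n-2}(-1)^{j+1}\tfrac{(i_j-1)(i_{j+1}-1)}{D_j}\,v(0)[i_1|\dots|i_j+i_{j+1}|\dots|i_{n-1}|1|0]\\ &+\sum_{j=1}^{n-2}(-1)^j\tfrac{i_j(i_j-1)}{D_j}[i_1|\dots|D_j|\dots|i_{n-1}|1|0]\\ &+\sum_{j=2}^{n-2}\sum_{t=1}^{j-1}(-1)^{j+1}i_t\tfrac{(i_j-1)(i_{j+1}-1)}{D_j}[i_1|\dots|i_t-1|\dots|i_j+i_{j+1}|\dots|i_{n-1}|1|0]\\ &+\sum_{j=2}^{n-2}\sum_{t=1}^{j-1}(-1)^j(i_t-1)\tfrac{i_ji_{j+1}}{D_j}[i_1|\dots|D_j|\dots|i_{n-1}|1|0]\\ &+(-1)^n\sum_{j=1}^{n-1}i_j[i_1|\dots|i_j-1|\dots|i_{n-1}|1]+(-1)^{n-1}\sum_{j=1}^{n-1}(i_j-1)[i_1|\dots|i_{n-1}|0]\\ &+(-1)^{n-1}v(1)[i_1|\dots|i_{n-1}|0]+(-1)^n[i_1|\dots|i_{n-1}|0]+(-1)^nv(0)[i_1|\dots|i_{n-1}|1].\end{aligned}$$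 (3) For $n=1$: $\delta_2[1|0]=v(1)[0]-v(0)[1]-[0]$. -/

import Mathlib

/-! Anick chains and the Anick differential of an augmented algebra `Λ` generated by letters
`x : X`, relative to a set `V` of obstructions (leading words of a Gröbner–Shirshov basis). -/

namespace Anick

open Classical

section Chains

variable {X : Type*} (V : Set (List X))

/-- `1 = a 1 < a 2 ≤ b 1 < a 3 ≤ b 2 < ⋯ < a n ≤ b (n-1) < b n = t` where `t` is the length of
`w = x_1 ⋯ x_t`, and every subword `x_{a j} ⋯ x_{b j}` with `1 ≤ j ≤ n` is an obstruction. -/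
def IsPrechainWitness (n : ℕ) (w : List X) (a b : ℕ → ℕ) : Prop :=
  a 1 = 1 ∧ b n = w.length ∧
  (∀ j, 1 ≤ j → j < n → a j < a (j + 1) ∧ a (j + 1) ≤ b j ∧ b j < b (j + 1)) ∧
  (∀ j, 1 ≤ j → j + 2 ≤ n → b j < a (j + 2)) ∧
  (∀ j, 1 ≤ j → j ≤ n → (w.drop (a j - 1)).take (b j + 1 - a j) ∈ V)

/-- `w` is an `n`-prechain (used for `n ≥ 1`). -/
def IsPrechain (n : ℕ) (w : List X) : Prop :=
  ∃ a b : ℕ → ℕ, IsPrechainWitness V n w a b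

/-- `w ∈ V^{(n)}`: the `0`-chains are the letters; for `n ≥ 1` an `n`-chain is an `n`-prechain for
which `a, b` can be chosen so that no `x_1 ⋯ x_s` with `s < b m`, `1 ≤ m ≤ n`, is an
`m`-prechain. -/
def IsChain : ℕ → List X → Prop
  | 0, w => w.length = 1
  | n + 1, w => ∃ a b : ℕ → ℕ, IsPrechainWitness V (n + 1) w a b ∧
      ∀ m, 1 ≤ m → m ≤ n + 1 → ∀ s, s < b m → ¬ IsPrechain V m (w.take s)

/-- `w` is `V`-reduced: no subword of `w` is an obstruction. -/
def IsReduced (w : List X) : Prop := ∀ u ∈ V, ¬ u <:+: w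

/-- The nontrivial `V`-reduced words. -/
def RedWord : Type _ := {w : List X // w ≠ [] ∧ IsReduced V w}

/-- The tuple `[w_1|…|w_n]` is an Anick chain (an element of `V^{(n-1)}`):
`w_1 ⋯ w_{j+1} ∈ V^{(j)}` for all `j < n`. The empty tuple is the only element of `V^{(-1)}`. -/
def IsChainTuple (l : List (RedWord V)) : Prop :=
  ∀ j, j < l.length → IsChain V j ((l.take (j + 1)).map Subtype.val).flatten

/-- The Anick chains forming the `Λ`-basis of `A_n`, i.e. `V^{(n-1)}`. -/
def Chain (n : ℕ) : Type _ := {l : List (RedWord V) // l.length = n ∧ IsChainTuple V l}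

/-- `l = [v_1|…|v_m]` has `v_1 ⋯ v_i ∈ V^{(i-1)}` and `v_{i+1} = v' v''` with both factors
nontrivial and `[v_1|…|v_i|v'] ∈ V^{(i)}`; `l'` is the tuple `[v_1|…|v_i|v'|v''|v_{i+2}|…|v_m]`. -/
def IsSplitting (l : List (RedWord V)) (i : ℕ) (l' : List (RedWord V)) : Prop :=
  ∃ (p q : List (RedWord V)) (v v' v'' : RedWord V),
    l = p ++ v :: q ∧ p.length = i ∧ v.1 = v'.1 ++ v''.1 ∧
    IsChainTuple V p ∧ IsChainTuple V (p ++ [v']) ∧ l' = p ++ v' :: v'' :: q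

/-- A splitting at the largest possible index. -/
def IsMaxSplitting (l : List (RedWord V)) (z : ℕ × List (RedWord V)) : Prop :=
  IsSplitting V l z.1 z.2 ∧ ∀ i l', IsSplitting V l i l' → i ≤ z.1

end Chains

noncomputable section Differential

variable {X : Type*} (V : Set (List X)) (k : Type*) [Field k]
  {Λ : Type*} [Ring Λ] [Algebra k Λ] (gen : X → Λ)

/-- The element of `Λ` represented by a word. -/
def wordValue (w : List X) : Λ := (w.map gen).prod

/-- The direct sum over `m` of the bar modules `B_m = Λ ⊗ (Λ/k)^{⊗ m}`: the free left `Λ`-module on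
the tuples `[w_1|…|w_m]` of nontrivial reduced words. -/
abbrev Bar (Λ : Type*) [Ring Λ] : Type _ := List (RedWord V) →₀ Λ

/-- The module `A_n = Λ ⊗ k V^{(n-1)}`. -/
abbrev AnickModule (Λ : Type*) [Ring Λ] (n : ℕ) : Type _ := Chain V n →₀ Λ

/-- The `V`-reduced form of the class of `x` in `Λ/k`: a linear combination of nontrivial reduced
words which equals `x` modulo `k · 1`. -/
def reducedForm (x : Λ) : RedWord V →₀ k :=
  if h : ∃ f : RedWord V →₀ k, ∃ c : k,
      x = algebraMap k Λ c + f.sum fun w r => r • wordValue gen w.1 then h.choose else 0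

/-- `[w_1|…|s|…|w_m]` where `s` is the reduced form of `w_{j+1} w_{j+2}`
(the two entries with `0`-based indices `j` and `j + 1`). -/
def contract (l : List (RedWord V)) (j : ℕ) : Bar V Λ :=
  match l.drop j with
  | u :: v :: q => (reducedForm V k gen (wordValue gen u.1 * wordValue gen v.1)).sum
      fun s r => Finsupp.single (l.take j ++ s :: q) (algebraMap k Λ r)
  | _ => 0

/-- `δ'` on basis elements:
`δ'[w_1|…|w_m] = w_1 [w_2|…|w_m] + ∑_{j=1}^{m-1} (-1)^j [w_1|…|s_j|…|w_m]`. -/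
def deltaOneBasis : List (RedWord V) → Bar V Λ
  | [] => 0
  | w :: t => Finsupp.single t (wordValue gen w.1) +
      ∑ j ∈ Finset.range t.length, (-1 : Λ) ^ (j + 1) • contract V k gen (w :: t) j

/-- `δ''` on basis elements. -/
def deltaTwoBasis (l : List (RedWord V)) : Bar V Λ :=
  if IsChainTuple V l then Finsupp.single l 1
  else if h : ∃ z : ℕ × List (RedWord V), IsMaxSplitting V l z then
    (-1 : Λ) ^ h.choose.1 • deltaOneBasis V k gen h.choose.2 + Finsupp.single l 1
  else 0

/-- The `Λ`-linear operator `δ''`. -/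
def deltaTwo : Bar V Λ →ₗ[Λ] Bar V Λ := Finsupp.linearCombination Λ (deltaTwoBasis V k gen)

/-- The inclusion of `A_n` into the bar modules. -/
def inclusion (Λ : Type*) [Ring Λ] (n : ℕ) : AnickModule V Λ n →ₗ[Λ] Bar V Λ :=
  Finsupp.lmapDomain Λ Λ Subtype.val

/-- `(δ'')^m (δ'[c]) = y` for all sufficiently large `m`. -/
def IsEventualValue {n : ℕ} (c : Chain V (n + 1)) (y : AnickModule V Λ n) : Prop :=
  ∃ K : ℕ, ∀ m, K ≤ m →
    (deltaTwo V k gen)^[m] (deltaOneBasis V k gen c.1) = inclusion V Λ n y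

/-- The Anick differential `δ_{n+1} : A_{n+1} → A_n`: the `Λ`-linear map sending a chain `c` to
`(δ'')^m (δ'[c])` for sufficiently large `m`. -/
def anickDifferential (n : ℕ) : AnickModule V Λ (n + 1) →ₗ[Λ] AnickModule V Λ n :=
  Finsupp.linearCombination Λ fun c =>
    if h : ∃ y, IsEventualValue V k gen c y then h.choose else 0

end Differential

end Anick

namespace U3

open Anick Classical

noncomputable section

variable (k : Type*) [Field k]

/-- The defining relations of `𝒜₊(U(3))` in the generators `v(n)`, `n ≥ 0`. -/
inductive Rel : FreeAlgebra k ℕ → FreeAlgebra k ℕ → Prop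
  | locality (n m : ℕ) (hn : 3 ≤ n) : Rel
      (FreeAlgebra.ι k n * FreeAlgebra.ι k m
        - 3 * (FreeAlgebra.ι k (n - 1) * FreeAlgebra.ι k (m + 1))
        + 3 * (FreeAlgebra.ι k (n - 2) * FreeAlgebra.ι k (m + 2))
        - FreeAlgebra.ι k (n - 3) * FreeAlgebra.ι k (m + 3)) 0
  | commutator (n m : ℕ) (hnm : m < n) : Rel
      (FreeAlgebra.ι k n * FreeAlgebra.ι k m - FreeAlgebra.ι k m * FreeAlgebra.ι k n)
      (((n : k) - (m : k)) • FreeAlgebra.ι k (n + m - 1))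

/-- The augmented algebra `Λ = 𝒜₊(U(3)) ⊕ k·1`. -/
abbrev Alg : Type _ := RingQuot (Rel k)

/-- The generator `v(n)`. -/
def v (n : ℕ) : Alg k := RingQuot.mkAlgHom k (Rel k) (FreeAlgebra.ι k n)

/-- The leading words `v(1)v(0)` and `v(n)v(m)`, `n ≥ 2`, `m ≥ 0`, of the Gröbner–Shirshov basis. -/
def obstructions : Set (List ℕ) := {w | w = [1, 0] ∨ ∃ n m : ℕ, 2 ≤ n ∧ w = [n, m]}

/-- The one-letter word `v(n)` as a reduced word. -/
def letter (n : ℕ) : RedWord obstructions :=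
  ⟨[n], by simp, by
    rintro u hu h
    have hl := h.length_le
    rcases hu with rfl | ⟨a, b, -, rfl⟩ <;> simp at hl⟩

/-- The tuple `[i 1|i 2|…|i n]` of generators. -/
def tuple (n : ℕ) (i : ℕ → ℕ) : List (RedWord obstructions) :=
  (List.range n).map fun j => letter (i (j + 1))

/-- The element `[i 1|…|i n]` of `A_n`; it is `0` if the tuple is not an Anick chain. -/
def br (n : ℕ) (i : ℕ → ℕ) : AnickModule obstructions (Alg k) n :=
  if h : IsChainTuple obstructions (tuple n i) then
    Finsupp.single ⟨tuple n i, by simp [tuple], h⟩ 1 else 0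

/-- The sequence `i` with the two terms `i j, i (j+1)` replaced by the single term `c`. -/
def merge (i : ℕ → ℕ) (j c : ℕ) : ℕ → ℕ :=
  fun t => if t < j then i t else if t = j then c else i (t + 1)

/-- The sequence `i` with the term `i t` replaced by `i t - 1`. -/
def dec (i : ℕ → ℕ) (t : ℕ) : ℕ → ℕ := Function.update i t (i t - 1)

/-- The Anick differential `δ_{n+1} : A_{n+1} → A_n` of `Λ = 𝒜₊(U(3)) ⊕ k·1`. -/
def delta (n : ℕ) : AnickModule obstructions (Alg k) (n + 1) →ₗ[Alg k]
    AnickModule obstructions (Alg k) n :=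
  anickDifferential obstructions k (v k) n

end

end U3

/-!
The algebra `Λ` has the basis of reduced words `v(0)^a v(1)^b` and `v(0)^a v(1)^b v(n)`, `n ≥ 2`.
By locality `v(n) v(N - n)` is a quadratic function of `n`, which together with the commutation
relations gives the rewriting rules (`U3.v_mul_v`); hence the reduced words span. They are
independent because `Λ` acts on the tensor densities `t^{S + d}` of indeterminate weight `L`, with
`S` an indeterminate as well, by `-(t^n ∂ + n L t^{n-1})` (`U3.genericRep`), and the vectors `w e_0` for reduced `w` have
pairwise different leading terms (`U3.linearIndependent_reduced`). So the reduced form of an element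
can be read off from any expression as a combination of nontrivial reduced words
(`U3.reducedForm_eq`).

All obstructions have two letters, so Anick chains are the tuples of letters all of whose adjacent
pairs are obstructions (`U3.isChainTuple_iff`), and `δ''` on a tuple is governed by its first entry
which is not a letter: either this entry `u' u''` splits after its first letter, and then
`δ''[p|u'u''|q] = ±δ'[p|u'|u''|q] + [p|u'u''|q]`, in which the contraction of `u'` and `u''` cancels
the given tuple, or `δ''` gives zero.

A contraction of a chain produces tuples `[p|v(0)v(E)|q]` and `[p|v(1)v(D)|q]`, where all letters of
`p` have index at least two. The main point is that the iterates of `δ''` move the letters `v(0)`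
and `v(1)` to the left through `p`, by `v(n) v(0) = v(0) v(n) + n v(n-1)` and
`v(n) v(1) = v(1) v(n) + (n-1) v(n)`, while all other terms die (`U3.zeroMoves_and_oneMoves`). It is
proved by induction on the length of `p`: after splitting, only the contraction of the last letter
of `p` with the `v(0)` or `v(1)` following it survives, since in every other term the letters
following the first long entry do not form a chain (`U3.ev_front`), or the letters before it do not.
The exceptional tuples `[p|v(1)|v(0)v(E)|q]`, which do split further, have eventual value zero
(`U3.ev_one_pair_zero`). Summing over all contractions of a chain gives the formulas.
-/

namespace U3

open Anick Classical

/-! ### Reduced words and chains -/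

/-- The two-letter word `v(a) v(b)` is an obstruction. -/
def Obs (a b : ℕ) : Prop := (a = 1 ∧ b = 0) ∨ 2 ≤ a

theorem pair_mem_obstructions {a b : ℕ} : [a, b] ∈ obstructions ↔ Obs a b := by
  simp only [obstructions, Obs, Set.mem_ofPred_eq, List.cons.injEq, and_true]
  constructor
  · rintro (h | ⟨n, m, hn, rfl, rfl⟩)
    · exact Or.inl h
    · exact Or.inr hn
  · rintro (h | h)
    · exact Or.inl h
    · exact Or.inr ⟨a, b, h, rfl, rfl⟩

theorem exists_pair_of_mem_obstructions {w : List ℕ} (h : w ∈ obstructions) :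
    ∃ a b, w = [a, b] ∧ Obs a b := by
  rcases h with rfl | ⟨n, m, hn, rfl⟩
  · exact ⟨1, 0, rfl, Or.inl ⟨rfl, rfl⟩⟩
  · exact ⟨n, m, rfl, Or.inr hn⟩

theorem not_obs_zero (b : ℕ) : ¬ Obs 0 b := by simp [Obs]

theorem not_obs_one {b : ℕ} (hb : b ≠ 0) : ¬ Obs 1 b := by simp [Obs, hb]

theorem isReduced_iff {w : List ℕ} :
    IsReduced obstructions w ↔ w.IsChain fun a b => ¬ Obs a b := by
  rw [List.isChain_iff_forall_rel_of_append_cons_cons]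
  constructor
  · intro h a b l₁ l₂ hw hab
    exact h [a, b] (pair_mem_obstructions.2 hab) ⟨l₁, l₂, by simp [hw]⟩
  · rintro h u hu ⟨l₁, l₂, hw⟩
    obtain ⟨a, b, rfl, hab⟩ := exists_pair_of_mem_obstructions hu
    exact h (l₁ := l₁) (l₂ := l₂) (by simp [← hw]) hab

/-- Since every obstruction has length two, a prechain leaves no choice for the positions of its
obstructions: the `j`-th one covers the letters `j` and `j + 1`. -/
theorem prechainWitness_positions {n : ℕ} {w : List ℕ} {a b : ℕ → ℕ}
    (h : IsPrechainWitness obstructions n w a b) {j : ℕ} (h1 : 1 ≤ j) (hj : j ≤ n) :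
    a j = j ∧ b j = j + 1 := by
  obtain ⟨ha, hb, hstep, -, hmem⟩ := h
  -- without this bound `take` could cut off a longer range at the end of the word
  have hble : ∀ d j, 1 ≤ j → j + d = n → b j ≤ w.length := by
    intro d
    induction d with
    | zero => intro j _ hj; rw [← hb, ← hj]; simp
    | succ d ih =>
      intro j h1 hj
      have := ih (j + 1) (by omega) (by omega)
      have := (hstep j h1 (by omega)).2.2
      omega
  have hba : ∀ j, 1 ≤ j → j ≤ n → 1 ≤ a j → b j = a j + 1 := by
    intro j h1 hj haj
    obtain ⟨x, y, hxy, -⟩ := exists_pair_of_mem_obstructions (hmem j h1 hj)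
    have hl := congrArg List.length hxy
    simp only [List.length_take, List.length_drop, List.length_cons, List.length_nil] at hl
    have := hble (n - j) j h1 (by omega)
    omega
  have key : a j = j := by
    induction j, h1 using Nat.le_induction with
    | base => exact ha
    | succ j h1 ih =>
      have haj := ih (by omega)
      have := hstep j h1 (by omega)
      have := hba j h1 (by omega) (by omega)
      omega
  exact ⟨key, by rw [hba j h1 hj (by omega), key]⟩

theorem length_eq_of_isPrechain {n : ℕ} {w : List ℕ} (hn : 1 ≤ n)
    (h : IsPrechain obstructions n w) : w.length = n + 1 := by
  obtain ⟨a, b, h⟩ := h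
  rw [← (prechainWitness_positions h hn le_rfl).2, h.2.1]

/-- The `n`-chains are the words of length `n + 1` in which all adjacent pairs are obstructions. -/
theorem isChain_iff {n : ℕ} {w : List ℕ} :
    Anick.IsChain obstructions n w ↔ w.length = n + 1 ∧ w.IsChain Obs := by
  cases n with
  | zero =>
    simp only [Anick.IsChain]
    constructor
    · intro h
      obtain ⟨a, rfl⟩ := List.length_eq_one_iff.1 h
      simp
    · exact fun h => h.1
  | succ n =>
    have hsub : ∀ (j : ℕ) (hj : j + 1 < w.length), (w.drop j).take 2 = [w[j], w[j + 1]] := by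
      intro j hj
      rw [List.drop_eq_getElem_cons (by omega), List.drop_eq_getElem_cons hj]
      rfl
    constructor
    · rintro ⟨a, b, h, -⟩
      have hlen : w.length = n + 1 + 1 := length_eq_of_isPrechain (by omega) ⟨a, b, h⟩
      refine ⟨hlen, List.isChain_iff_getElem.2 fun j hj => ?_⟩
      have hp := prechainWitness_positions h (j := j + 1) (by omega) (by omega)
      have hm := h.2.2.2.2 (j + 1) (by omega) (by omega)
      rw [hp.1, hp.2, show j + 1 + 1 + 1 - (j + 1) = 2 by omega, Nat.add_sub_cancel,
        hsub j hj] at hm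
      exact pair_mem_obstructions.1 hm
    · rintro ⟨hlen, hw⟩
      refine ⟨fun j => j, fun j => j + 1, ⟨rfl, hlen.symm, fun j _ _ => by dsimp only; omega,
        fun j _ _ => by dsimp only; omega, fun j h1 hj => ?_⟩, fun m h1 hm s hs hpre => ?_⟩
      · obtain ⟨j, rfl⟩ : ∃ j', j = j' + 1 := ⟨j - 1, by omega⟩
        simp only [show j + 1 + 1 + 1 - (j + 1) = 2 by omega, Nat.add_sub_cancel]
        rw [hsub j (by omega)]
        exact pair_mem_obstructions.2 (List.isChain_iff_getElem.1 hw j (by omega))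
      · have := length_eq_of_isPrechain h1 hpre
        simp only [List.length_take] at this hs
        omega

/-! ### Tuples of letters -/

theorem letter_injective : Function.Injective letter := fun a b h => by
  simpa [letter] using congrArg Subtype.val h

@[simp] theorem letter_val (a : ℕ) : (letter a).1 = [a] := rfl

/-- The tuple `[v(a)|v(b)|…]` of the letters with the given indices. -/
def letters (xs : List ℕ) : List (RedWord obstructions) := xs.map letter

@[simp] theorem letters_nil : letters [] = [] := rfl

@[simp] theorem letters_cons (x : ℕ) (xs : List ℕ) :
    letters (x :: xs) = letter x :: letters xs := rfl

@[simp] theorem letters_append (xs ys : List ℕ) :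
    letters (xs ++ ys) = letters xs ++ letters ys := List.map_append

@[simp] theorem length_letters (xs : List ℕ) : (letters xs).length = xs.length :=
  List.length_map _

theorem letters_injective : Function.Injective letters := List.map_injective_iff.2 letter_injective

/-- The product `w_1 ⋯ w_n` of a tuple `[w_1|…|w_n]`. -/
def concat (l : List (RedWord obstructions)) : List ℕ := (l.map Subtype.val).flatten

theorem concat_append (l l' : List (RedWord obstructions)) :
    concat (l ++ l') = concat l ++ concat l' := by
  unfold concat
  exact (congrArg List.flatten List.map_append).trans List.flatten_append

theorem concat_singleton (w : RedWord obstructions) : concat [w] = w.1 := List.append_nil _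

theorem concat_letters (xs : List ℕ) : concat (letters xs) = xs := by
  induction xs with
  | nil => rfl
  | cons x xs ih =>
    rw [letters_cons, ← List.singleton_append, concat_append, ih]
    rfl

/-- The Anick chains are the tuples of letters all of whose adjacent pairs are obstructions. -/
theorem isChainTuple_iff {l : List (RedWord obstructions)} :
    IsChainTuple obstructions l ↔ ∃ xs : List ℕ, l = letters xs ∧ xs.IsChain Obs := by
  constructor
  · intro h
    have hlet : ∀ j, j ≤ l.length → ∃ xs : List ℕ, l.take j = letters xs := by
      intro j
      induction j with
      | zero => exact fun _ => ⟨[], rfl⟩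
      | succ j ih =>
        intro hj
        obtain ⟨xs, hxs⟩ := ih (by omega)
        have hlen := (isChain_iff.1 (h j (by omega))).1
        change (concat _).length = _ at hlen
        rw [List.take_succ_eq_append_getElem (by omega), hxs, concat_append, concat_letters,
          concat_singleton] at hlen
        have hx : xs.length = j := by
          rw [← length_letters, ← hxs, List.length_take]; omega
        rw [List.length_append, hx] at hlen
        obtain ⟨a, ha⟩ := List.length_eq_one_iff.1 (show (l[j].1).length = 1 by omega)
        refine ⟨xs ++ [a], ?_⟩
        rw [List.take_succ_eq_append_getElem (by omega), hxs, letters_append]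
        congr 2
        exact Subtype.ext ha
    obtain ⟨xs, hxs⟩ := hlet l.length le_rfl
    rw [List.take_length] at hxs
    refine ⟨xs, hxs, ?_⟩
    cases hn : xs.length with
    | zero => rw [List.length_eq_zero_iff.1 hn]; exact List.isChain_nil
    | succ n =>
      have := (isChain_iff.1 (h n (by rw [hxs, length_letters]; omega))).2
      change (concat _).IsChain Obs at this
      rwa [hxs, List.take_of_length_le (by rw [length_letters]; omega), concat_letters] at this
  · rintro ⟨xs, rfl, hxs⟩ j hj
    rw [length_letters] at hj
    change Anick.IsChain obstructions j (concat _)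
    rw [letters, ← List.map_take, ← letters, concat_letters]
    exact isChain_iff.2 ⟨by rw [List.length_take]; omega, hxs.take _⟩

theorem isChainTuple_letters {xs : List ℕ} :
    IsChainTuple obstructions (letters xs) ↔ xs.IsChain Obs := by
  rw [isChainTuple_iff]
  constructor
  · rintro ⟨ys, h, hys⟩
    rwa [letters_injective h]
  · exact fun h => ⟨xs, rfl, h⟩

/-! ### Splittings -/

/-- If the `i`-th entry is the first one which is not a letter, then every splitting happens
there. -/
theorem isSplitting_letters_append {xs : List ℕ} {w : RedWord obstructions}
    {l l' : List (RedWord obstructions)} (hw : 2 ≤ w.1.length) {i : ℕ}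
    (h : IsSplitting obstructions (letters xs ++ w :: l) i l') :
    i = xs.length ∧ ∃ (x : ℕ) (w' : RedWord obstructions), w.1 = x :: w'.1 ∧
      (xs ++ [x]).IsChain Obs ∧ l' = letters xs ++ letter x :: w' :: l := by
  obtain ⟨p, q, v, v', v'', hl, hi, hv, hp, hp', rfl⟩ := h
  obtain ⟨ys, rfl, -⟩ := isChainTuple_iff.1 hp
  obtain ⟨zs, hzs, hz⟩ := isChainTuple_iff.1 hp'
  have hv2 : 2 ≤ v.1.length := by
    have h1 := List.length_pos_of_ne_nil v'.2.1
    have h2 := List.length_pos_of_ne_nil v''.2.1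
    rw [hv, List.length_append]; omega
  have hlen : ys.length = xs.length := by
    rcases lt_trichotomy ys.length xs.length with hlt | heq | hgt
    · have hg := congrArg (fun l => l[ys.length]?) hl
      simp [List.getElem?_append, hlt, letters] at hg
      rw [← hg] at hv2
      simp at hv2
    · exact heq
    · have hg := congrArg (fun l => l[xs.length]?) hl
      simp [List.getElem?_append, hgt, letters] at hg
      rw [hg] at hw
      simp at hw
  obtain ⟨h1, h2⟩ := List.append_inj hl (by simp [hlen])
  obtain rfl := letters_injective h1
  obtain ⟨rfl, rfl⟩ := List.cons.inj h2
  rcases List.eq_nil_or_concat' zs with rfl | ⟨zs, x, rfl⟩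
  · simp at hzs
  rw [letters_append] at hzs
  obtain ⟨h3, h4⟩ := List.append_inj' hzs (by simp)
  obtain rfl := letters_injective h3
  simp only [letters_cons, letters_nil, List.cons.injEq, and_true] at h4
  subst h4
  exact ⟨by simpa using hi.symm, x, v'', by simpa using hv, hz, rfl⟩

theorem not_isSplitting_letters {xs : List ℕ} {i : ℕ} {l' : List (RedWord obstructions)} :
    ¬ IsSplitting obstructions (letters xs) i l' := by
  rintro ⟨p, q, v, v', v'', hl, -, hv, -, -, -⟩
  have hmem : v ∈ letters xs := by rw [hl]; simp
  obtain ⟨x, -, rfl⟩ := List.mem_map.1 hmem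
  have h1 := List.length_pos_of_ne_nil v'.2.1
  have h2 := List.length_pos_of_ne_nil v''.2.1
  have := congrArg List.length hv
  simp only [letter_val, List.length_append, List.length_cons, List.length_nil] at this
  omega

section DeltaTwo

variable (k : Type*) [Field k] {Λ : Type*} [Ring Λ] [Algebra k Λ] (gen : ℕ → Λ)

theorem neg_one_pow_smul {M : Type*} [AddCommGroup M] [Module Λ M]
    [Module k M] [IsScalarTower k Λ M] (n : ℕ) (x : M) : (-1 : Λ) ^ n • x = (-1 : k) ^ n • x := by
  rw [← algebraMap_smul Λ ((-1 : k) ^ n) x, map_pow, map_neg, map_one]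

/-- The tuple of letters `[xs]` if it is an Anick chain, and `0` otherwise; this is the value of
`δ''` on `[xs]`. -/
noncomputable def chainOrZero (Λ : Type*) [Ring Λ] (xs : List ℕ) : Bar obstructions Λ :=
  if xs.IsChain Obs then Finsupp.single (letters xs) 1 else 0

theorem chainOrZero_of_not (Λ : Type*) [Ring Λ] {xs : List ℕ} (h : ¬ xs.IsChain Obs) :
    chainOrZero Λ xs = 0 :=
  if_neg h

theorem deltaTwo_single (l : List (RedWord obstructions)) :
    deltaTwo obstructions k gen (Finsupp.single l 1) = deltaTwoBasis obstructions k gen l := by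
  simp [deltaTwo]

theorem deltaTwo_letters (xs : List ℕ) :
    deltaTwo obstructions k gen (Finsupp.single (letters xs) 1) = chainOrZero Λ xs := by
  rw [deltaTwo_single, deltaTwoBasis, chainOrZero, isChainTuple_letters]
  split_ifs with h1 h2
  · rfl
  · obtain ⟨z, hz⟩ := h2
    exact (not_isSplitting_letters hz.1).elim
  · rfl

/-- `δ''` kills a tuple which starts with letters not forming a chain, or for which the first
letter of the first longer entry does not prolong the chain of letters before it. -/
theorem deltaTwo_eq_zero {xs : List ℕ} {x : ℕ} {w : RedWord obstructions} {t : List ℕ}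
    (hw : w.1 = x :: t) (hx : ¬ (xs ++ [x]).IsChain Obs) (l : List (RedWord obstructions)) :
    deltaTwo obstructions k gen (Finsupp.single (letters xs ++ w :: l) 1) = 0 := by
  have hchain : ¬ IsChainTuple obstructions (letters xs ++ w :: l) := by
    rw [isChainTuple_iff]
    rintro ⟨ys, hys, hc⟩
    obtain ⟨p, q, rfl, hp, hq⟩ : ∃ p q, ys = p ++ q ∧ letters p = letters xs ∧
        letters q = w :: l := by
      obtain ⟨p, q, h1, h2, h3⟩ := List.append_eq_map_iff.1 hys
      exact ⟨p, q, h1, h2, h3⟩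
    obtain rfl := letters_injective hp
    cases q with
    | nil => simp at hq
    | cons y q =>
      rw [letters_cons, List.cons.injEq] at hq
      rw [← hq.1, letter_val, List.cons.injEq] at hw
      rw [hw.1] at hc
      exact hx (hc.prefix ⟨q, by simp⟩)
  rw [deltaTwo_single, deltaTwoBasis, if_neg hchain, dif_neg]
  rintro ⟨z, ⟨p, q, u, u', u'', hl, hi, hu, hp, hp', hz⟩, -⟩
  by_cases ht : t = []
  · subst ht
    obtain rfl : w = letter x := Subtype.ext hw
    obtain ⟨ys, hys, hc⟩ := isChainTuple_iff.1 hp'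
    have hu2 : 2 ≤ u.1.length := by
      have h1 := List.length_pos_of_ne_nil u'.2.1
      have h2 := List.length_pos_of_ne_nil u''.2.1
      rw [hu, List.length_append]; omega
    have hlen : xs.length < p.length := by
      by_contra hlt
      push Not at hlt
      have hg := congrArg (fun l => l[p.length]?) hl
      have hmem : u ∈ letters (xs ++ [x]) := by
        rw [show letters xs ++ letter x :: l = letters (xs ++ [x]) ++ l by simp] at hg
        simp only [List.getElem?_append, lt_irrefl, if_false, Nat.sub_self,
          List.getElem?_cons_zero] at hg
        rw [if_pos (by simp; omega)] at hg
        exact List.mem_of_getElem? hg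
      obtain ⟨y, -, rfl⟩ := List.mem_map.1 hmem
      simp at hu2
    obtain ⟨zs, rfl, hzs⟩ := isChainTuple_iff.1 hp
    have hpre : letters (xs ++ [x]) <+: letters zs := by
      apply List.prefix_of_prefix_length_le (l₃ := letters xs ++ letter x :: l)
      · exact ⟨l, by simp⟩
      · rw [hl]; exact List.prefix_append _ _
      · simpa using hlen
    obtain ⟨r, hr⟩ := hpre
    obtain ⟨a, b, rfl, h2, h3⟩ := List.append_eq_map_iff.1 hr
    rw [letters_injective h2] at hzs
    exact hx hzs.left_of_append
  · obtain ⟨-, y, w', hy, hc, -⟩ := isSplitting_letters_append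
      (by
        have := List.length_pos_of_ne_nil ht
        rw [hw, List.length_cons]; omega) ⟨p, q, u, u', u'', hl, hi, hu, hp, hp', hz⟩
    rw [hw, List.cons.injEq] at hy
    rw [← hy.1] at hc
    exact hx hc

/-- If the first entry `w = x w'` which is not a letter splits, it does so after its first letter,
as chains consist of letters. -/
theorem deltaTwo_split {xs : List ℕ} {x : ℕ} {w w' : RedWord obstructions}
    (hw : w.1 = x :: w'.1) (hx : (xs ++ [x]).IsChain Obs) (l : List (RedWord obstructions)) :
    deltaTwo obstructions k gen (Finsupp.single (letters xs ++ w :: l) 1) =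
      (-1 : k) ^ xs.length •
        deltaOneBasis obstructions k gen (letters xs ++ letter x :: w' :: l) +
      Finsupp.single (letters xs ++ w :: l) 1 := by
  have hw2 : 2 ≤ w.1.length := by
    have := List.length_pos_of_ne_nil w'.2.1
    rw [hw, List.length_cons]; omega
  have hchain : ¬ IsChainTuple obstructions (letters xs ++ w :: l) := by
    rw [isChainTuple_iff]
    rintro ⟨ys, hys, -⟩
    have hmem : w ∈ letters ys := by rw [← hys]; simp
    obtain ⟨y, -, rfl⟩ := List.mem_map.1 hmem
    simp at hw2
  have huniq : ∀ i l', IsSplitting obstructions (letters xs ++ w :: l) i l' →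
      i = xs.length ∧ l' = letters xs ++ letter x :: w' :: l := by
    intro i l' h
    obtain ⟨hi, y, w'', hy, -, hl'⟩ := isSplitting_letters_append hw2 h
    rw [hw, List.cons.injEq] at hy
    obtain ⟨rfl, h2⟩ := hy
    obtain rfl : w' = w'' := Subtype.ext h2
    exact ⟨hi, hl'⟩
  have hex : ∃ z, IsMaxSplitting obstructions (letters xs ++ w :: l) z := by
    refine ⟨(xs.length, letters xs ++ letter x :: w' :: l), ⟨letters xs, l, w, letter x, w', rfl,
      by simp, hw, isChainTuple_letters.2 hx.left_of_append, ?_, rfl⟩, fun i l' h => ?_⟩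
    · simpa using isChainTuple_letters.2 hx
    · exact (huniq i l' h).1.le
  rw [deltaTwo_single, deltaTwoBasis, if_neg hchain, dif_pos hex]
  obtain ⟨h1, h2⟩ := huniq _ _ hex.choose_spec.1
  rw [h1, h2, neg_one_pow_smul k]

end DeltaTwo

/-! ### The Gröbner–Shirshov relations -/

section Relations

variable (k : Type*) [Field k]

theorem v_locality (n m : ℕ) :
    v k (n + 3) * v k m - 3 * (v k (n + 2) * v k (m + 1)) + 3 * (v k (n + 1) * v k (m + 2))
      - v k n * v k (m + 3) = 0 := by
  have h := RingQuot.mkAlgHom_rel k (Rel.locality (k := k) (n + 3) m (by omega))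
  simpa only [map_sub, map_add, map_mul, map_zero, map_ofNat, v, Nat.add_sub_cancel,
    show n + 3 - 1 = n + 2 by omega, show n + 3 - 2 = n + 1 by omega] using h

theorem v_commutator {n m : ℕ} (h : m < n) :
    v k n * v k m - v k m * v k n = ((n : k) - m) • v k (n + m - 1) := by
  simpa only [map_sub, map_mul, map_smul, v] using
    RingQuot.mkAlgHom_rel k (Rel.commutator (k := k) n m h)

theorem v_mul_v_zero (n : ℕ) : v k n * v k 0 = v k 0 * v k n + (n : k) • v k (n - 1) := by
  rcases Nat.eq_zero_or_pos n with rfl | h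
  · simp
  · have := v_commutator k h
    rw [sub_eq_iff_eq_add'] at this
    simpa using this

theorem v_mul_v_one {n : ℕ} (h : 2 ≤ n) :
    v k n * v k 1 = v k 1 * v k n + ((n : k) - 1) • v k n := by
  have := v_commutator k (show 1 < n by omega)
  rw [sub_eq_iff_eq_add'] at this
  simpa using this

variable [CharZero k]

/-- By locality, the products `v(n) v(N - n)` depend quadratically on `n`. -/
theorem v_mul_v_quadratic (N n : ℕ) (hn : n ≤ N) :
    v k n * v k (N - n) = ((n : k) * (n - 1) / 2) • (v k 2 * v k (N - 2))
      - ((n : k) * (n - 2)) • (v k 1 * v k (N - 1))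
      + (((n : k) - 1) * (n - 2) / 2) • (v k 0 * v k N) := by
  induction n using Nat.strong_induction_on with
  | _ n ih =>
    match n, hn, ih with
    | 0, _, _ => simp
    | 1, _, _ => match_scalars <;> norm_num
    | 2, _, _ => norm_num
    | n + 3, hn, ih =>
      have h := v_locality k n (N - (n + 3))
      rw [show N - (n + 3) + 1 = N - (n + 2) by omega, show N - (n + 3) + 2 = N - (n + 1) by omega,
        show N - (n + 3) + 3 = N - n by omega, ih n (by omega) (by omega),
        ih (n + 1) (by omega) (by omega), ih (n + 2) (by omega) (by omega)] at h
      have h3 : ∀ y : Alg k, 3 * y = (3 : k) • y := fun y => by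
        rw [Algebra.smul_def, map_ofNat]
      rw [h3, h3] at h
      generalize v k (n + 3) * v k (N - (n + 3)) = X at h ⊢
      rw [← sub_eq_zero, ← h]
      push_cast
      match_scalars <;> field_simp <;> ring

/-- The Gröbner–Shirshov relation, which holds for all `n + m ≥ 2`. -/
theorem v_mul_v {n m : ℕ} (h : 2 ≤ n + m) :
    v k n * v k m = ((n : k) * m / ((n : k) + m - 1)) • (v k 1 * v k (n + m - 1))
      + (-(((n : k) - 1) * ((m : k) - 1) / ((n : k) + m - 1))) • (v k 0 * v k (n + m))
      + ((n : k) * ((n : k) - 1) / ((n : k) + m - 1)) • v k (n + m - 1) := by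
  -- the second instance, with `v(n + m) v(0)` commuted, determines `v(2) v(n + m - 2)`
  have h1 := v_mul_v_quadratic k (n + m) n (by omega)
  have h2 := v_mul_v_quadratic k (n + m) (n + m) le_rfl
  have h3 := v_mul_v_zero k (n + m)
  rw [Nat.add_sub_cancel_left] at h1
  rw [Nat.sub_self, h3] at h2
  have hN : ((n : k) + m - 1) ≠ 0 := by
    have : ((n + m - 1 : ℕ) : k) ≠ 0 := Nat.cast_ne_zero.2 (by omega)
    rwa [Nat.cast_sub (by omega), Nat.cast_add, Nat.cast_one] at this
  have hN' : ((n : k) + m) ≠ 0 := by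
    have : ((n + m : ℕ) : k) ≠ 0 := Nat.cast_ne_zero.2 (by omega)
    rwa [Nat.cast_add] at this
  have h4 : v k 2 * v k (n + m - 2) = (2 / (((n : k) + m) * ((n : k) + m - 1))) •
      (v k 0 * v k (n + m) + ((n : k) + m) • v k (n + m - 1)
        + (((n : k) + m) * ((n : k) + m - 2)) • (v k 1 * v k (n + m - 1))
        - (((n : k) + m - 1) * ((n : k) + m - 2) / 2) • (v k 0 * v k (n + m))) := by
    push_cast at h2
    rw [h2]
    match_scalars <;> field_simp <;> ring
  rw [h1, h4]
  match_scalars <;> field_simp <;> ring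

end Relations

/-! ### The reduced words span -/

section Spanning

variable (k : Type*) [Field k]

/-- The span of the reduced words. -/
def redSpan : Submodule k (Alg k) :=
  Submodule.span k (Set.range (fun w : {w : List ℕ // IsReduced obstructions w} =>
    wordValue (v k) w.1))

variable {k}

theorem wordValue_cons (a : ℕ) (w : List ℕ) :
    wordValue (v k) (a :: w) = v k a * wordValue (v k) w := by simp [wordValue]

theorem mul_mem_redSpan_of {c : Alg k} (h : ∀ w, IsReduced obstructions w →
    c * wordValue (v k) w ∈ redSpan k) {x : Alg k} (hx : x ∈ redSpan k) : c * x ∈ redSpan k := by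
  induction hx using Submodule.span_induction with
  | mem x hx =>
    obtain ⟨w, rfl⟩ := hx
    exact h w.1 w.2
  | zero => simp
  | add x y _ _ hx hy => rw [mul_add]; exact add_mem hx hy
  | smul r x _ hx => rw [mul_smul_comm]; exact Submodule.smul_mem _ _ hx

theorem wordValue_mem_redSpan {w : List ℕ} (h : IsReduced obstructions w) :
    wordValue (v k) w ∈ redSpan k := Submodule.subset_span ⟨⟨w, h⟩, rfl⟩

theorem isReduced_cons {a : ℕ} {w : List ℕ} (hw : IsReduced obstructions w)
    (h : ∀ b ∈ w.head?, ¬ Obs a b) : IsReduced obstructions (a :: w) :=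
  isReduced_iff.2 (List.isChain_cons.2 ⟨h, isReduced_iff.1 hw⟩)

theorem isReduced_of_cons {a : ℕ} {w : List ℕ} (hw : IsReduced obstructions (a :: w)) :
    IsReduced obstructions w :=
  isReduced_iff.2 (List.isChain_cons.1 (isReduced_iff.1 hw)).2

theorem v_zero_mul_mem {x : Alg k} (hx : x ∈ redSpan k) : v k 0 * x ∈ redSpan k :=
  mul_mem_redSpan_of (fun w hw => by
    rw [← wordValue_cons]
    exact wordValue_mem_redSpan (isReduced_cons hw fun b _ => not_obs_zero b)) hx

theorem v_one_mul_mem {x : Alg k} (hx : x ∈ redSpan k) : v k 1 * x ∈ redSpan k := by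
  refine mul_mem_redSpan_of (fun w hw => ?_) hx
  induction w with
  | nil =>
    rw [← wordValue_cons]
    exact wordValue_mem_redSpan (isReduced_cons hw (by simp))
  | cons a w ih =>
    by_cases ha : a = 0
    · subst ha
      have hw' := isReduced_of_cons hw
      rw [wordValue_cons, ← mul_assoc, v_mul_v_zero, add_mul, mul_assoc, smul_mul_assoc]
      exact add_mem (v_zero_mul_mem (ih hw'))
        (Submodule.smul_mem _ _ (v_zero_mul_mem (wordValue_mem_redSpan hw')))
    · rw [← wordValue_cons]
      exact wordValue_mem_redSpan (isReduced_cons hw (by simpa using not_obs_one ha))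

variable [CharZero k]

theorem v_mul_mem (n : ℕ) {x : Alg k} (hx : x ∈ redSpan k) : v k n * x ∈ redSpan k := by
  refine mul_mem_redSpan_of (fun w hw => ?_) hx
  clear hx x
  induction w generalizing n with
  | nil =>
    rw [← wordValue_cons]
    exact wordValue_mem_redSpan (isReduced_cons hw (by simp))
  | cons a w ih =>
    match n with
    | 0 => exact v_zero_mul_mem (wordValue_mem_redSpan hw)
    | 1 => exact v_one_mul_mem (wordValue_mem_redSpan hw)
    | n + 2 =>
      have hw' := isReduced_of_cons hw
      rw [wordValue_cons, ← mul_assoc]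
      match a, hw with
      | 0, _ =>
        rw [v_mul_v_zero, add_mul, mul_assoc, smul_mul_assoc]
        exact add_mem (v_zero_mul_mem (ih _ hw')) (Submodule.smul_mem _ _ (ih _ hw'))
      | 1, _ =>
        rw [v_mul_v_one k (by omega), add_mul, mul_assoc, smul_mul_assoc]
        exact add_mem (v_one_mul_mem (ih _ hw')) (Submodule.smul_mem _ _ (ih _ hw'))
      | a + 2, hw =>
        obtain rfl : w = [] := by
          cases w with
          | nil => rfl
          | cons b w =>
            exact ((List.isChain_cons_cons.1 (isReduced_iff.1 hw)).1 (Or.inr (by omega))).elim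
        rw [v_mul_v k (by omega)]
        simp only [add_mul, smul_mul_assoc, mul_assoc]
        exact add_mem (add_mem (Submodule.smul_mem _ _ (v_one_mul_mem (ih _ hw')))
          (Submodule.smul_mem _ _ (v_zero_mul_mem (ih _ hw'))))
          (Submodule.smul_mem _ _ (ih _ hw'))

theorem redSpan_eq_top : redSpan k = ⊤ := by
  -- the span contains `1` and is stable under left multiplication by the generators
  have key : ∀ (y : FreeAlgebra k ℕ) (x : Alg k), x ∈ redSpan k →
      RingQuot.mkAlgHom k (Rel k) y * x ∈ redSpan k := by
    intro y
    induction y using FreeAlgebra.induction with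
    | grade0 r =>
      intro x hx
      rw [AlgHom.commutes, ← Algebra.smul_def]
      exact Submodule.smul_mem _ _ hx
    | grade1 n => exact fun x hx => v_mul_mem n hx
    | mul a b ha hb =>
      intro x hx
      rw [map_mul, mul_assoc]
      exact ha _ (hb _ hx)
    | add a b ha hb =>
      intro x hx
      rw [map_add, add_mul]
      exact add_mem (ha _ hx) (hb _ hx)
  rw [eq_top_iff]
  intro x _
  obtain ⟨y, rfl⟩ := RingQuot.mkAlgHom_surjective k (Rel k) x
  have h1 : (1 : Alg k) ∈ redSpan k :=
    wordValue_mem_redSpan (w := []) (isReduced_iff.2 List.isChain_nil)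
  simpa using key y 1 h1

end Spanning

/-! ### The reduced words are linearly independent -/

section Independence

open Polynomial

variable (k : Type*) [Field k]

/-- `v(n)` acts on the families `(f_d)_{d ∈ ℤ}` in `k[S][L]` by
`v(n) e_d = -(S + d + n L) e_{d + n - 1}`; this is the action of `-(t^n ∂ + n L t^{n-1})` on
`t^{S + d}`. -/
noncomputable def genericAction (n : ℕ) : Module.End k (ℤ → k[X][X]) where
  toFun f e := -(C (X + C ((e - n + 1 : ℤ) : k)) + (n : k[X][X]) * X) * f (e - n + 1)
  map_add' f g := by ext1 e; simp only [Pi.add_apply]; ring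
  map_smul' r f := by
    ext1 e; simp only [Pi.smul_apply, RingHom.id_apply, mul_smul_comm]

theorem genericAction_apply (n : ℕ) (f : ℤ → k[X][X]) (e : ℤ) :
    genericAction k n f e =
      -(C (X + C ((e - n + 1 : ℤ) : k)) + (n : k[X][X]) * X) * f (e - n + 1) := rfl

theorem genericAction_rel {x y : FreeAlgebra k ℕ} (h : Rel k x y) :
    FreeAlgebra.lift k (genericAction k) x = FreeAlgebra.lift k (genericAction k) y := by
  have smul_eq : ∀ (r : k) (p : k[X][X]), r • p = C (C r) * p := fun r p => by
    rw [Algebra.smul_def]; rfl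
  cases h with
  | locality n m hn =>
    obtain ⟨n, rfl⟩ : ∃ n', n = n' + 3 := ⟨n - 3, by omega⟩
    simp only [map_sub, map_add, map_mul, map_zero, map_ofNat, FreeAlgebra.lift_ι_apply]
    ext1 f
    ext1 e
    have three : ∀ (g : ℤ → k[X][X]), (3 : Module.End k (ℤ → k[X][X])) g = 3 • g := fun g => by
      simp
    simp only [LinearMap.sub_apply, LinearMap.add_apply, Module.End.mul_apply, three,
      Pi.sub_apply, Pi.add_apply, Pi.smul_apply, genericAction_apply, LinearMap.zero_apply,
      Pi.zero_apply]
    rw [show n + 3 - 1 = n + 2 by omega, show n + 3 - 2 = n + 1 by omega, Nat.add_sub_cancel]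
    have e1 : e - ((n + 3 : ℕ) : ℤ) + 1 - (m : ℤ) + 1 = e - n - m - 1 := by push_cast; ring
    have e2 : e - ((n + 2 : ℕ) : ℤ) + 1 - ((m + 1 : ℕ) : ℤ) + 1 = e - n - m - 1 := by
      push_cast; ring
    have e3 : e - ((n + 1 : ℕ) : ℤ) + 1 - ((m + 2 : ℕ) : ℤ) + 1 = e - n - m - 1 := by
      push_cast; ring
    have e4 : e - (n : ℤ) + 1 - ((m + 3 : ℕ) : ℤ) + 1 = e - n - m - 1 := by push_cast; ring
    rw [e1, e2, e3, e4]
    simp only [nsmul_eq_mul]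
    push_cast
    simp only [map_add, map_sub, map_one, map_natCast, map_intCast, map_ofNat]
    ring
  | commutator n m hnm =>
    obtain ⟨n, rfl⟩ : ∃ n', n = n' + 1 := ⟨n - 1, by omega⟩
    simp only [map_sub, map_mul, map_smul, FreeAlgebra.lift_ι_apply]
    ext1 f
    ext1 e
    simp only [LinearMap.sub_apply, Module.End.mul_apply, LinearMap.smul_apply,
      Pi.sub_apply, Pi.smul_apply, genericAction_apply]
    rw [show n + 1 + m - 1 = n + m by omega, smul_eq]
    have e1 : e - ((n + 1 : ℕ) : ℤ) + 1 - (m : ℤ) + 1 = e - n - m + 1 := by push_cast; ring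
    have e2 : e - (m : ℤ) + 1 - ((n + 1 : ℕ) : ℤ) + 1 = e - n - m + 1 := by push_cast; ring
    have e3 : e - ((n + m : ℕ) : ℤ) + 1 = e - n - m + 1 := by push_cast; ring
    rw [e1, e2, e3]
    push_cast
    simp only [map_add, map_sub, map_one, map_natCast, map_intCast]
    ring

/-- The representation of `Λ` by `genericAction`. -/
noncomputable def genericRep : Alg k →ₐ[k] Module.End k (ℤ → k[X][X]) :=
  RingQuot.liftAlgHom k ⟨FreeAlgebra.lift k (genericAction k), fun _ _ h => genericAction_rel k h⟩

theorem genericRep_v (n : ℕ) : genericRep k (v k n) = genericAction k n := by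
  simp [genericRep, v, RingQuot.liftAlgHom_mkAlgHom_apply]

theorem genericAction_single (n : ℕ) (d : ℤ) (p : k[X][X]) :
    genericAction k n (Pi.single d p) =
      Pi.single (d + n - 1) (-(C (X + C (d : k)) + (n : k[X][X]) * X) * p) := by
  ext1 e
  rw [genericAction_apply]
  by_cases h : e = d + n - 1
  · subst h
    rw [show d + (n : ℤ) - 1 - n + 1 = d by ring]
    simp
  · rw [Pi.single_eq_of_ne h, Pi.single_eq_of_ne (fun h' => h (by omega)), mul_zero]

/-- The degree of a word, where `v(n)` has degree `n - 1`. -/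
def wordDegree : List ℕ → ℤ
  | [] => 0
  | a :: w => wordDegree w + a - 1

/-- The coefficient of `w e_0`, which is a multiple of `e_d` for the degree `d` of `w`. -/
noncomputable def wordPoly : List ℕ → k[X][X]
  | [] => 1
  | a :: w => -(C (X + C (wordDegree w : k)) + (a : k[X][X]) * X) * wordPoly w

theorem genericRep_wordValue (w : List ℕ) :
    genericRep k (wordValue (v k) w) (Pi.single 0 1) = Pi.single (wordDegree w) (wordPoly k w) := by
  induction w with
  | nil => simp [wordValue, wordDegree, wordPoly]
  | cons a w ih =>
    rw [wordValue_cons, map_mul, Module.End.mul_apply, ih, genericRep_v, genericAction_single]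
    rfl

/-- A reduced word has the form `v(0)^a v(1)^b` or `v(0)^a v(1)^b v(n)` with `n ≥ 2`. -/
theorem exists_of_isReduced {w : List ℕ} (hw : IsReduced obstructions w) :
    ∃ (a b : ℕ) (t : List ℕ), w = List.replicate a 0 ++ (List.replicate b 1 ++ t) ∧
      (t = [] ∨ ∃ n, 2 ≤ n ∧ t = [n]) := by
  induction w with
  | nil => exact ⟨0, 0, [], rfl, Or.inl rfl⟩
  | cons x w ih =>
    obtain ⟨a, b, t, rfl, ht⟩ := ih (isReduced_of_cons hw)
    match x, hw with
    | 0, _ => exact ⟨a + 1, b, t, by simp [List.replicate_succ], ht⟩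
    | 1, hw =>
      cases a with
      | zero => exact ⟨0, b + 1, t, by simp [List.replicate_succ], ht⟩
      | succ a =>
        rw [List.replicate_succ] at hw
        exact ((List.isChain_cons_cons.1 (isReduced_iff.1 hw)).1 (Or.inl ⟨rfl, rfl⟩)).elim
    | x + 2, hw =>
      have hnil : List.replicate a 0 ++ (List.replicate b 1 ++ t) = [] := by
        cases h : List.replicate a 0 ++ (List.replicate b 1 ++ t) with
        | nil => rfl
        | cons b l =>
          rw [h] at hw
          exact ((List.isChain_cons_cons.1 (isReduced_iff.1 hw)).1 (Or.inr (by omega))).elim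
      exact ⟨0, 0, [x + 2], by simp [hnil], Or.inr ⟨x + 2, by omega, rfl⟩⟩

/-- The exponents `(ℓ, σ)` of the leading monomial `S^σ L^ℓ` of `wordPoly w`, with `ℓ` taking
precedence. -/
def wordLead (w : List ℕ) : ℕ ×ₗ ℕ := toLex ((w.filter (· ≠ 0)).length, w.count 0)

/-- A reduced word is determined by its degree and its leading exponents. -/
theorem wordKey_injOn {w w' : List ℕ} (hw : IsReduced obstructions w)
    (hw' : IsReduced obstructions w') (hd : wordDegree w = wordDegree w')
    (hl : wordLead w = wordLead w') : w = w' := by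
  have deg : ∀ (a b : ℕ) (t : List ℕ), wordDegree
      (List.replicate a 0 ++ (List.replicate b 1 ++ t)) = wordDegree t - a := by
    intro a b t
    have h1 : wordDegree (List.replicate b 1 ++ t) = wordDegree t := by
      induction b with
      | zero => simp
      | succ b ih => rw [List.replicate_succ, List.cons_append, wordDegree, ih]; simp
    induction a with
    | zero => simp [h1]
    | succ a ih => rw [List.replicate_succ, List.cons_append, wordDegree, ih]; push_cast; ring
  obtain ⟨a, b, t, rfl, ht⟩ := exists_of_isReduced hw
  obtain ⟨a', b', t', rfl, ht'⟩ := exists_of_isReduced hw'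
  rw [deg, deg] at hd
  have lead : ∀ (a b : ℕ) (t : List ℕ), (t = [] ∨ ∃ n, 2 ≤ n ∧ t = [n]) → wordLead
      (List.replicate a 0 ++ (List.replicate b 1 ++ t)) = toLex (b + t.length, a) := by
    rintro a b t (rfl | ⟨n, hn, rfl⟩)
    · simp [wordLead, List.count_replicate]
    · simp [wordLead, List.count_replicate, show n ≠ 0 by omega]
  rw [lead a b t ht, lead a' b' t' ht'] at hl
  obtain ⟨hb, rfl⟩ := Prod.ext_iff.1 (toLex.injective hl)
  simp only at hb
  rcases ht with rfl | ⟨n, hn, rfl⟩ <;> rcases ht' with rfl | ⟨n', hn', rfl⟩ <;>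
    simp only [wordDegree, List.length_nil, List.length_cons] at hd hb
  · rw [show b = b' by omega]
  · omega
  · omega
  · rw [show b = b' by omega, show n = n' by omega]

/-- A family of vectors is independent if each vector has a nonzero coordinate, indexed injectively
by its leading position, which vanishes on the vectors of smaller leading position. -/
theorem linearIndependent_of_leading {ι K M : Type*} [LinearOrder K] [AddCommGroup M] [Module k M]
    (x : ι → M) (key : ι → K) (φ : K → M →ₗ[k] k) (hne : ∀ i, φ (key i) (x i) ≠ 0)
    (hlt : ∀ i j, j ≠ i → key j ≤ key i → φ (key i) (x j) = 0) : LinearIndependent k x := by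
  rw [linearIndependent_iff']
  intro s g hg
  by_contra! hcon
  obtain ⟨i₀, hi₀, hgi₀⟩ := hcon
  obtain ⟨i, hi, hmax⟩ := (s.filter fun i => g i ≠ 0).exists_max_image key
    ⟨i₀, Finset.mem_filter.2 ⟨hi₀, hgi₀⟩⟩
  rw [Finset.mem_filter] at hi
  have := congrArg (φ (key i)) hg
  rw [map_sum, map_zero, Finset.sum_eq_single i] at this
  · rw [map_smul, smul_eq_mul] at this
    exact mul_ne_zero hi.2 (hne i) this
  · intro j hj hji
    by_cases hgj : g j = 0
    · simp [hgj]
    · rw [map_smul, hlt i j hji (hmax j (Finset.mem_filter.2 ⟨hj, hgj⟩)), smul_zero]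
  · exact fun h => (h hi.1).elim

variable [CharZero k]

theorem wordPoly_lead {w : List ℕ} (hw : IsReduced obstructions w) :
    wordPoly k w ≠ 0 ∧ (wordPoly k w).natDegree = (ofLex (wordLead w)).1 ∧
      (wordPoly k w).leadingCoeff.natDegree = (ofLex (wordLead w)).2 := by
  induction w with
  | nil => simp [wordPoly, wordLead]
  | cons a w ih =>
    obtain ⟨h0, h1, h2⟩ := ih (isReduced_of_cons hw)
    by_cases ha : a = 0
    · subst ha
      have hX : (X + C (wordDegree w : k)) ≠ 0 := X_add_C_ne_zero _
      have hform : wordPoly k (0 :: w) = C (-(X + C (wordDegree w : k))) * wordPoly k w := by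
        simp [wordPoly]
      rw [hform]
      refine ⟨mul_ne_zero (by rwa [Ne, C_eq_zero, neg_eq_zero]) h0, ?_, ?_⟩
      · rw [natDegree_C_mul (neg_ne_zero.2 hX), h1]
        simp [wordLead]
      · rw [leadingCoeff_mul, leadingCoeff_C, natDegree_mul (neg_ne_zero.2 hX)
          (leadingCoeff_ne_zero.2 h0), natDegree_neg, natDegree_X_add_C, h2]
        simp [wordLead, add_comm]
    · have hak : (-(a : k)) ≠ 0 := neg_ne_zero.2 (Nat.cast_ne_zero.2 ha)
      have hak' : (C (-(a : k))) ≠ 0 := by rwa [Ne, C_eq_zero]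
      have hform : wordPoly k (a :: w) =
          (C (C (-(a : k))) * X + C (-(X + C (wordDegree w : k)))) * wordPoly k w := by
        rw [wordPoly]
        simp only [map_neg, map_natCast]
        ring
      rw [hform]
      have hdeg := natDegree_linear (a := C (-(a : k))) (b := -(X + C (wordDegree w : k))) hak'
      have hlead := leadingCoeff_linear (a := C (-(a : k))) (b := -(X + C (wordDegree w : k))) hak'
      have hne : C (C (-(a : k))) * X + C (-(X + C (wordDegree w : k))) ≠ 0 := by
        rw [← leadingCoeff_ne_zero, hlead]; exact hak'
      refine ⟨mul_ne_zero hne h0, ?_, ?_⟩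
      · rw [natDegree_mul hne h0, hdeg, h1]
        simp [wordLead, ha, add_comm]
      · rw [leadingCoeff_mul, hlead, natDegree_C_mul hak, h2]
        simp [wordLead, ha]

/-- The reduced words are linearly independent: in the generic representation their values at `e_0`
have pairwise different leading terms. -/
theorem linearIndependent_reduced : LinearIndependent k
    (fun w : {w : List ℕ // IsReduced obstructions w} => wordValue (v k) w.1) := by
  let ev : Alg k →ₗ[k] (ℤ → k[X][X]) :=
    (LinearMap.applyₗ (Pi.single 0 1 : ℤ → k[X][X])).comp (genericRep k).toLinearMap
  have hev : ∀ w : List ℕ, ev (wordValue (v k) w) = Pi.single (wordDegree w) (wordPoly k w) :=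
    genericRep_wordValue k
  refine LinearIndependent.of_comp ev (linearIndependent_of_leading k (K := ℤ ×ₗ (ℕ ×ₗ ℕ)) _
    (fun w => toLex (wordDegree w.1, wordLead w.1))
    (fun κ => (lcoeff k (ofLex (ofLex κ).2).2).comp
      (((lcoeff k[X] (ofLex (ofLex κ).2).1).restrictScalars k).comp
        (LinearMap.proj (ofLex κ).1))) ?_ ?_)
  · rintro ⟨w, hw⟩
    obtain ⟨h0, h1, h2⟩ := wordPoly_lead k hw
    simp only [Function.comp_apply, hev, LinearMap.comp_apply, LinearMap.proj_apply, ofLex_toLex,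
      Pi.single_eq_same, LinearMap.restrictScalars_apply, lcoeff_apply, ← h1, ← h2,
      coeff_natDegree]
    simpa using h0
  · rintro ⟨w, hw⟩ ⟨w', hw'⟩ hne hle
    obtain ⟨h0, h1, h2⟩ := wordPoly_lead k hw'
    simp only [Function.comp_apply, hev, LinearMap.comp_apply, LinearMap.proj_apply, ofLex_toLex,
      LinearMap.restrictScalars_apply, lcoeff_apply]
    by_cases hd : wordDegree w = wordDegree w'
    · rw [hd, Pi.single_eq_same]
      have hlt : wordLead w' < wordLead w := by
        refine lt_of_le_of_ne ?_ fun h => hne (Subtype.ext (wordKey_injOn hw' hw hd.symm h))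
        rw [Prod.Lex.toLex_le_toLex] at hle
        rcases hle with h | h
        · exact absurd h (by simp [hd])
        · exact h.2
      rcases Prod.Lex.lt_iff.1 hlt with h | ⟨h, h'⟩
      · rw [coeff_eq_zero_of_natDegree_lt (p := wordPoly k w') (by rw [h1]; exact h), coeff_zero]
      · rw [← h, ← h1, coeff_natDegree, coeff_eq_zero_of_natDegree_lt (by rw [h2]; exact h')]
    · rw [Pi.single_eq_of_ne hd, coeff_zero, coeff_zero]

end Independence

/-! ### Contractions -/

/-- The facts on the algebra `Λ` which determine the Anick differential: the reduced words are
linearly independent and the products of two generators reduce as in the Gröbner–Shirshov basis. -/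
structure ReducesBy (k : Type*) [Field k] {Λ : Type*} [Ring Λ] [Algebra k Λ] (gen : ℕ → Λ) :
    Prop where
  indep : LinearIndependent k
    (fun w : {w : List ℕ // IsReduced obstructions w} => wordValue gen w.1)
  mul_zero (n : ℕ) : gen n * gen 0 = gen 0 * gen n + (n : k) • gen (n - 1)
  mul_one {n : ℕ} (h : 2 ≤ n) : gen n * gen 1 = gen 1 * gen n + ((n : k) - 1) • gen n
  mul {n m : ℕ} (h : 2 ≤ n + m) :
    gen n * gen m = ((n : k) * m / ((n : k) + m - 1)) • (gen 1 * gen (n + m - 1))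
      + (-(((n : k) - 1) * ((m : k) - 1) / ((n : k) + m - 1))) • (gen 0 * gen (n + m))
      + ((n : k) * ((n : k) - 1) / ((n : k) + m - 1)) • gen (n + m - 1)

theorem reducesBy_v (k : Type*) [Field k] [CharZero k] : ReducesBy k (v k) where
  indep := linearIndependent_reduced k
  mul_zero := v_mul_v_zero k
  mul_one := v_mul_v_one k
  mul := v_mul_v k

section Contract

variable {k : Type*} [Field k] {Λ : Type*} [Ring Λ] [Algebra k Λ] {gen : ℕ → Λ}

/-- By the independence of the reduced words, a linear combination of nontrivial reduced words
is its own reduced form. -/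
theorem reducedForm_eq (H : ReducesBy k gen) {f : RedWord obstructions →₀ k} {x : Λ}
    (hx : x = f.sum fun w r => r • wordValue gen w.1) :
    reducedForm obstructions k gen x = f := by
  have hex : ∃ f : RedWord obstructions →₀ k, ∃ c : k,
      x = algebraMap k Λ c + f.sum fun w r => r • wordValue gen w.1 :=
    ⟨f, 0, by rw [map_zero, zero_add, hx]⟩
  rw [reducedForm, dif_pos hex]
  obtain ⟨c, hc⟩ := hex.choose_spec
  set g := hex.choose
  let ι : RedWord obstructions → {w : List ℕ // IsReduced obstructions w} := fun w => ⟨w.1, w.2.2⟩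
  have hι : Function.Injective ι := fun a b h =>
    Subtype.ext (congrArg (fun w : {w : List ℕ // IsReduced obstructions w} => w.1) h)
  let e : {w : List ℕ // IsReduced obstructions w} := ⟨[], isReduced_iff.2 List.isChain_nil⟩
  have hlin : g.mapDomain ι + Finsupp.single e c = f.mapDomain ι := by
    apply H.indep
    rw [map_add, Finsupp.linearCombination_mapDomain, Finsupp.linearCombination_mapDomain,
      Finsupp.linearCombination_single, Finsupp.linearCombination_apply,
      Finsupp.linearCombination_apply]
    rw [hx] at hc
    refine Eq.trans ?_ hc.symm
    rw [add_comm, Algebra.algebraMap_eq_smul_one]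
    rfl
  ext w
  have := DFunLike.congr_fun hlin (ι w)
  rw [Finsupp.add_apply, Finsupp.mapDomain_apply hι, Finsupp.mapDomain_apply hι,
    Finsupp.single_eq_of_ne, add_zero] at this
  · exact this
  · intro h
    exact w.2.1 (congrArg Subtype.val h)

/-- A contraction is computed from any expression of the product as a combination of nontrivial
reduced words. -/
theorem contract_eq (H : ReducesBy k gen) (p q : List (RedWord obstructions))
    {u w w₁ w₂ w₃ : RedWord obstructions}
    {r₁ r₂ r₃ : k} (h : wordValue gen u.1 * wordValue gen w.1 =
      r₁ • wordValue gen w₁.1 + r₂ • wordValue gen w₂.1 + r₃ • wordValue gen w₃.1) :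
    contract obstructions k gen (p ++ u :: w :: q) p.length =
      r₁ • Finsupp.single (p ++ w₁ :: q) 1 + r₂ • Finsupp.single (p ++ w₂ :: q) 1
        + r₃ • Finsupp.single (p ++ w₃ :: q) 1 := by
  have hf := reducedForm_eq H (f := Finsupp.single w₁ r₁ + Finsupp.single w₂ r₂
    + Finsupp.single w₃ r₃) (x := wordValue gen u.1 * wordValue gen w.1) (by
      rw [← Finsupp.linearCombination_apply, map_add, map_add]
      simp only [Finsupp.linearCombination_single]
      exact h)
  have hsum : ∀ f : RedWord obstructions →₀ k,
      (f.sum fun s r => Finsupp.single (p ++ s :: q) (algebraMap k Λ r)) =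
        Finsupp.linearCombination k
          (fun s => Finsupp.single (p ++ s :: q) (1 : Λ)) f := by
    intro f
    rw [Finsupp.linearCombination_apply]
    congr! 3
    rw [Finsupp.smul_single, Algebra.algebraMap_eq_smul_one]
  simp only [contract, List.drop_left, List.take_left]
  rw [hf, hsum, map_add, map_add]
  simp only [Finsupp.linearCombination_single]

/-- The reduced two-letter word `v(a) v(b)`. -/
def pair (a b : ℕ) (h : ¬ Obs a b) : RedWord obstructions :=
  ⟨[a, b], by simp, isReduced_iff.2 (by simpa using h)⟩

@[simp] theorem pair_val {a b : ℕ} (h : ¬ Obs a b) : (pair a b h).1 = [a, b] := rfl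

theorem contract_pair (H : ReducesBy k gen) (p q : List (RedWord obstructions))
    {a b : ℕ} (h : ¬ Obs a b) :
    contract obstructions k gen (p ++ letter a :: letter b :: q) p.length =
      Finsupp.single (p ++ pair a b h :: q) 1 := by
  rw [contract_eq H p q (w₁ := pair a b h) (w₂ := letter 0) (w₃ := letter 0) (r₁ := 1) (r₂ := 0)
    (r₃ := 0) (by simp [wordValue])]
  simp

theorem contract_letters (H : ReducesBy k gen) (p q : List (RedWord obstructions))
    {a b : ℕ} (hab : 2 ≤ a + b) (h : ¬ Obs 1 (a + b - 1)) :
    contract obstructions k gen (p ++ letter a :: letter b :: q) p.length =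
      ((a : k) * b / ((a : k) + b - 1)) • Finsupp.single (p ++ pair 1 (a + b - 1) h :: q) 1
      + (-(((a : k) - 1) * ((b : k) - 1) / ((a : k) + b - 1))) •
          Finsupp.single (p ++ pair 0 (a + b) (not_obs_zero _) :: q) 1
      + ((a : k) * ((a : k) - 1) / ((a : k) + b - 1)) •
          Finsupp.single (p ++ letter (a + b - 1) :: q) 1 :=
  contract_eq H p q (by simpa [wordValue] using H.mul hab)

theorem contract_zero (H : ReducesBy k gen) (p q : List (RedWord obstructions)) (a : ℕ) :
    contract obstructions k gen (p ++ letter a :: letter 0 :: q) p.length =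
      Finsupp.single (p ++ pair 0 a (not_obs_zero _) :: q) 1
      + (a : k) • Finsupp.single (p ++ letter (a - 1) :: q) 1 := by
  rw [contract_eq H p q (w₁ := pair 0 a (not_obs_zero _)) (w₂ := letter (a - 1)) (w₃ := letter 0)
    (r₁ := 1) (r₂ := a) (r₃ := 0) (by simpa [wordValue] using H.mul_zero a)]
  simp

theorem contract_one (H : ReducesBy k gen) (p q : List (RedWord obstructions))
    {a : ℕ} (ha : 2 ≤ a) (h : ¬ Obs 1 a) :
    contract obstructions k gen (p ++ letter a :: letter 1 :: q) p.length =
      Finsupp.single (p ++ pair 1 a h :: q) 1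
      + ((a : k) - 1) • Finsupp.single (p ++ letter a :: q) 1 := by
  rw [contract_eq H p q (w₁ := pair 1 a h) (w₂ := letter a) (w₃ := letter 0)
    (r₁ := 1) (r₂ := a - 1) (r₃ := 0) (by simpa [wordValue] using H.mul_one ha)]
  simp

end Contract

/-! ### Eventual values of the iterates of `δ''` -/

section Eventual

variable (k : Type*) [Field k] {Λ : Type*} [Ring Λ] [Algebra k Λ] (gen : ℕ → Λ)

/-- The sequence `(δ'')^m x` is eventually constant with value `y`. -/
def Ev (x y : Bar obstructions Λ) : Prop :=
  ∃ K : ℕ, ∀ m, K ≤ m → (deltaTwo obstructions k gen)^[m] x = y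

variable {k gen}

theorem Ev.add {x y x' y' : Bar obstructions Λ} (h : Ev k gen x y) (h' : Ev k gen x' y') :
    Ev k gen (x + x') (y + y') := by
  obtain ⟨K, hK⟩ := h
  obtain ⟨K', hK'⟩ := h'
  refine ⟨max K K', fun m hm => ?_⟩
  rw [iterate_map_add, hK m (by omega), hK' m (by omega)]

theorem Ev.smul (c : Λ) {x y : Bar obstructions Λ} (h : Ev k gen x y) :
    Ev k gen (c • x) (c • y) := by
  obtain ⟨K, hK⟩ := h
  refine ⟨K, fun m hm => ?_⟩
  rw [← Module.End.pow_apply, map_smul, Module.End.pow_apply, hK m hm]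

theorem Ev.scalar (r : k) {x y : Bar obstructions Λ} (h : Ev k gen x y) :
    Ev k gen (r • x) (r • y) := by
  rw [← algebraMap_smul Λ r x, ← algebraMap_smul Λ r y]
  exact h.smul _

theorem Ev.zero : Ev k gen 0 0 := ⟨0, fun m _ => iterate_map_zero _ m⟩

theorem Ev.sum {ι : Type*} (s : Finset ι) {x y : ι → Bar obstructions Λ}
    (h : ∀ i ∈ s, Ev k gen (x i) (y i)) : Ev k gen (∑ i ∈ s, x i) (∑ i ∈ s, y i) := by
  induction s using Finset.induction_on with
  | empty => exact Ev.zero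
  | insert a s ha ih =>
    rw [Finset.sum_insert ha, Finset.sum_insert ha]
    exact (h a (Finset.mem_insert_self a s)).add
      (ih fun i hi => h i (Finset.mem_insert_of_mem hi))

theorem Ev.of_step {x y : Bar obstructions Λ}
    (h : Ev k gen (deltaTwo obstructions k gen x) y) : Ev k gen x y := by
  obtain ⟨K, hK⟩ := h
  refine ⟨K + 1, fun m hm => ?_⟩
  obtain ⟨m, rfl⟩ : ∃ m', m = m' + 1 := ⟨m - 1, by omega⟩
  rw [Function.iterate_succ_apply]
  exact hK m (by omega)

theorem Ev.of_eq_zero {x : Bar obstructions Λ} (h : deltaTwo obstructions k gen x = 0) :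
    Ev k gen x 0 := Ev.of_step (by rw [h]; exact Ev.zero)

theorem Ev.letters (xs : List ℕ) :
    Ev k gen (Finsupp.single (U3.letters xs) 1) (chainOrZero Λ xs) := by
  apply Ev.of_step
  rw [deltaTwo_letters k gen]
  refine ⟨0, fun m _ => Function.iterate_fixed ?_ m⟩
  rw [chainOrZero]
  split_ifs with h
  · rw [deltaTwo_letters, chainOrZero, if_pos h]
  · exact map_zero _

theorem Ev.letters_zero {xs : List ℕ} (h : ¬ xs.IsChain Obs) :
    Ev k gen (Finsupp.single (U3.letters xs) 1) 0 :=
  chainOrZero_of_not Λ h ▸ Ev.letters xs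

theorem not_isChain_append_cons_cons {xs ys : List ℕ} {x y : ℕ} (h : ¬ Obs x y) :
    ¬ (xs ++ x :: y :: ys).IsChain Obs := fun hc =>
  h (List.isChain_cons_cons.1 hc.right_of_append).1

theorem not_isChain_append {xs ys : List ℕ} (h : ¬ ys.IsChain Obs) :
    ¬ (xs ++ ys).IsChain Obs := fun hc => h hc.right_of_append

/-- If no chain begins with the letters `xs` and another one, then contractions behind `xs` are
killed by `δ''`. -/
theorem deltaTwo_contract_eq_zero {xs : List ℕ} (hxs : ∀ x, ¬ (xs ++ [x]).IsChain Obs)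
    (l : List (RedWord obstructions)) {j : ℕ} (hj : xs.length ≤ j) :
    deltaTwo obstructions k gen (contract obstructions k gen (U3.letters xs ++ l) j) = 0 := by
  have hdead : ∀ (w : RedWord obstructions) (l : List (RedWord obstructions)) (c : Λ),
      deltaTwo obstructions k gen (Finsupp.single (U3.letters xs ++ w :: l) c) = 0 := by
    intro w l c
    obtain ⟨x, t, hw⟩ := List.exists_cons_of_ne_nil w.2.1
    rw [show Finsupp.single (U3.letters xs ++ w :: l) c
      = c • Finsupp.single (U3.letters xs ++ w :: l) 1 by simp, map_smul,
      deltaTwo_eq_zero k gen hw (hxs x), smul_zero]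
  unfold contract
  split
  · rw [map_finsuppSum]
    refine Finset.sum_eq_zero fun s _ => ?_
    dsimp only
    rw [List.take_append, List.take_of_length_le (by simpa using hj), List.append_assoc]
    cases h : l.take (j - (U3.letters xs).length) with
    | nil => exact hdead _ _ _
    | cons w l' => exact hdead _ _ _
  · exact map_zero _

theorem contract_eq_zero_of_length_le {l : List (RedWord obstructions)} {j : ℕ}
    (h : l.length ≤ j + 1) : contract obstructions k gen l j = 0 := by
  unfold contract
  split
  · rename_i hd
    have := congrArg List.length hd
    simp only [List.length_drop, List.length_cons] at this
    omega
  · rfl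

/-- The first terms of `δ'[w_1|…|w_m]`: those which involve only `w_1, …, w_{s+1}`. -/
noncomputable def front (k : Type*) [Field k] {Λ : Type*} [Ring Λ] [Algebra k Λ] (gen : ℕ → Λ)
    (l : List (RedWord obstructions)) (s : ℕ) : Bar obstructions Λ :=
  (match l with
    | [] => 0
    | w :: t => Finsupp.single t (wordValue gen w.1)) +
  ∑ j ∈ Finset.range s, (-1 : k) ^ (j + 1) • contract obstructions k gen l j

theorem front_succ (l : List (RedWord obstructions)) (s : ℕ) :
    front k gen l (s + 1) =
      front k gen l s + (-1 : k) ^ (s + 1) • contract obstructions k gen l s := by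
  unfold front
  rw [Finset.sum_range_succ, ← add_assoc]

theorem deltaOneBasis_eq {l : List (RedWord obstructions)} {s d : ℕ} (h : l.length = s + d + 1) :
    deltaOneBasis obstructions k gen l = front k gen l s +
      ∑ j ∈ Finset.range d, (-1 : k) ^ (s + j + 1) • contract obstructions k gen l (s + j) := by
  cases l with
  | nil => simp at h
  | cons w t =>
    rw [List.length_cons, Nat.add_right_cancel_iff] at h
    simp only [deltaOneBasis, neg_one_pow_smul k]
    rw [front, h, Finset.sum_range_add, add_assoc]

/-- The eventual value of a tuple which splits behind the letters `xs`, into `[xs|h|b|q]`: in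
`δ'[xs|h|b|q]` the contraction of `h|b` gives back the tuple, and what is left are the terms in
front of it and those behind it. -/
theorem Ev.split (H : ReducesBy k gen) {xs : List ℕ} {h b : ℕ} (hb : ¬ Obs h b)
    (hx : (xs ++ [h]).IsChain Obs)
    (q : List (RedWord obstructions)) {y : Bar obstructions Λ}
    (hfront : Ev k gen (front k gen (U3.letters xs ++ letter h :: letter b :: q) xs.length)
      ((-1 : k) ^ xs.length • y))
    (hback : ∀ j, Ev k gen (contract obstructions k gen
      (U3.letters xs ++ letter h :: letter b :: q) (xs.length + 1 + j)) 0) :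
    Ev k gen (Finsupp.single (U3.letters xs ++ pair h b hb :: q) 1) y := by
  apply Ev.of_step
  rw [deltaTwo_split k gen (w := pair h b hb) (w' := letter b) rfl hx,
    deltaOneBasis_eq (s := xs.length) (d := q.length + 1) (by simp; omega),
    Finset.sum_range_succ', add_zero]
  have hc := contract_pair H (U3.letters xs) q hb
  rw [length_letters] at hc
  have hsign : (-1 : k) ^ xs.length * (-1) ^ xs.length = 1 := by
    rw [← pow_add, ← two_mul, pow_mul]; simp
  have hsign' : (-1 : k) ^ xs.length * (-1) ^ (xs.length + 1) = -1 := by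
    rw [pow_succ, ← mul_assoc, hsign, one_mul]
  rw [hc, smul_add, smul_add, smul_smul, hsign', neg_one_smul, ← add_assoc, neg_add_cancel_right]
  have h1 := hfront.scalar ((-1 : k) ^ xs.length)
  rw [smul_smul, hsign, one_smul] at h1
  have h2 : Ev k gen (∑ j ∈ Finset.range q.length, (-1 : k) ^ (xs.length + (j + 1) + 1) •
      contract obstructions k gen (U3.letters xs ++ letter h :: letter b :: q)
        (xs.length + (j + 1))) (∑ j ∈ Finset.range q.length, 0) := by
    refine Ev.sum _ fun j _ => ?_
    have := (hback j).scalar ((-1 : k) ^ (xs.length + (j + 1) + 1))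
    rwa [smul_zero, show xs.length + 1 + j = xs.length + (j + 1) by omega] at this
  simpa using h1.add (h2.scalar ((-1 : k) ^ xs.length))

end Eventual

/-! ### Moving `v(0)` and `v(1)` to the left through a chain -/

/-- The list of the terms `i 1, …, i n` of a sequence. -/
def seq (n : ℕ) (i : ℕ → ℕ) : List ℕ := (List.range n).map fun j => i (j + 1)

@[simp] theorem seq_zero (i : ℕ → ℕ) : seq 0 i = [] := rfl

@[simp] theorem length_seq (n : ℕ) (i : ℕ → ℕ) : (seq n i).length = n := by simp [seq]

theorem seq_succ (n : ℕ) (i : ℕ → ℕ) : seq (n + 1) i = seq n i ++ [i (n + 1)] := by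
  simp [seq, List.range_succ]

theorem seq_congr {n : ℕ} {i i' : ℕ → ℕ} (h : ∀ t, 1 ≤ t → t ≤ n → i t = i' t) :
    seq n i = seq n i' :=
  List.map_congr_left fun j hj => h _ (by omega) (List.mem_range.1 hj)

theorem seq_add (a b : ℕ) (i : ℕ → ℕ) : seq (a + b) i = seq a i ++ seq b fun t => i (a + t) := by
  induction b with
  | zero => simp
  | succ b ih => rw [← add_assoc, seq_succ, ih, seq_succ, List.append_assoc]; rfl

theorem seq_succ' (n : ℕ) (i : ℕ → ℕ) : seq (n + 1) i = i 1 :: seq n fun t => i (t + 1) := by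
  rw [add_comm, seq_add]
  simp [seq, add_comm]

theorem seq_add_two (a b : ℕ) (i : ℕ → ℕ) : seq (a + 2 + b) i =
    seq a i ++ i (a + 1) :: i (a + 2) :: seq b fun t => i (a + 2 + t) := by
  rw [seq_add, seq_succ, seq_succ]
  simp

theorem isChain_seq_append {s : ℕ} {i : ℕ → ℕ} (hi : ∀ t, 1 ≤ t → t ≤ s → 2 ≤ i t) {l : List ℕ}
    (hl : l.IsChain Obs) : (seq s i ++ l).IsChain Obs := by
  induction s generalizing l with
  | zero => simpa using hl
  | succ s ih =>
    rw [seq_succ, List.append_assoc]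
    exact ih (fun t h1 h2 => hi t h1 (by omega))
      (List.isChain_cons.2 ⟨fun b _ => Or.inr (hi (s + 1) (by omega) le_rfl), hl⟩)

theorem seq_dec_of_lt {s t : ℕ} (i : ℕ → ℕ) (h : s < t) : seq s (dec i t) = seq s i :=
  seq_congr fun u _ hu => by rw [dec, Function.update_of_ne (by omega)]

section Values

variable (k : Type*) [Field k] {Λ : Type*} [Ring Λ] [Algebra k Λ] (gen : ℕ → Λ) (i : ℕ → ℕ)

/-- The eventual value of `[i 1|…|i s|v(0)v(E)|q]`: by `v(n) v(0) = v(0) v(n) + n v(n-1)`, the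
letter `v(0)` moves to the left. -/
noncomputable def zeroValue (s E : ℕ) (q : List ℕ) : Bar obstructions Λ :=
  gen 0 • chainOrZero Λ (seq s i ++ E :: q) +
    ∑ t ∈ Finset.Icc 1 s, (i t : k) • chainOrZero Λ (seq s (dec i t) ++ E :: q)

/-- The eventual value of `[i 1|…|i s|v(1)v(D)|q]`: by `v(n) v(1) = v(1) v(n) + (n-1) v(n)`, the
letter `v(1)` moves to the left. -/
noncomputable def oneValue (s D : ℕ) (q : List ℕ) : Bar obstructions Λ :=
  gen 1 • chainOrZero Λ (seq s i ++ D :: q) +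
    ∑ t ∈ Finset.Icc 1 s, ((i t : k) - 1) • chainOrZero Λ (seq s i ++ D :: q)

theorem zeroValue_succ (s E : ℕ) (q : List ℕ) : zeroValue k gen i (s + 1) E q =
    zeroValue k gen i s (i (s + 1)) (E :: q) +
      (i (s + 1) : k) • chainOrZero Λ (seq s i ++ (i (s + 1) - 1) :: E :: q) := by
  rw [zeroValue, zeroValue, Finset.sum_Icc_succ_top (by omega), seq_succ, ← add_assoc]
  congr 1
  · congr 1
    · simp
    · refine Finset.sum_congr rfl fun t ht => ?_
      rw [Finset.mem_Icc] at ht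
      rw [seq_succ, show dec i t (s + 1) = i (s + 1) from Function.update_of_ne (by omega) _ _]
      simp
  · rw [seq_succ, seq_dec_of_lt i (by omega)]
    simp [dec]

theorem oneValue_succ (s D : ℕ) (q : List ℕ) : oneValue k gen i (s + 1) D q =
    oneValue k gen i s (i (s + 1)) (D :: q) +
      ((i (s + 1) : k) - 1) • chainOrZero Λ (seq s i ++ i (s + 1) :: D :: q) := by
  rw [oneValue, oneValue, Finset.sum_Icc_succ_top (by omega), seq_succ, ← add_assoc]
  simp

theorem zeroValue_eq_zero (s : ℕ) {E : ℕ} {q : List ℕ} (h : ¬ (E :: q).IsChain Obs) :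
    zeroValue k gen i s E q = 0 := by
  simp [zeroValue, chainOrZero_of_not Λ (not_isChain_append h)]

theorem oneValue_eq_zero (s : ℕ) {D : ℕ} {q : List ℕ} (h : ¬ (D :: q).IsChain Obs) :
    oneValue k gen i s D q = 0 := by
  simp [oneValue, chainOrZero_of_not Λ (not_isChain_append h)]

/-- The tuples `[i 1|…|i s|v(0)v(E)|q]` have the expected eventual value. -/
def ZeroMoves (s : ℕ) : Prop := ∀ (E : ℕ) (q : List ℕ),
  Ev k gen (Finsupp.single (letters (seq s i) ++ pair 0 E (not_obs_zero E) :: letters q) 1)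
    (zeroValue k gen i s E q)

/-- The tuples `[i 1|…|i s|v(1)v(D)|q]` have the expected eventual value. For `D = 1` this needs
`q` to be empty: `[v(1)v(1)|v(0)]` behaves differently. -/
def OneMoves (s : ℕ) : Prop := ∀ (D : ℕ) (h : ¬ Obs 1 D) (q : List ℕ), (2 ≤ D ∨ q = []) →
  Ev k gen (Finsupp.single (letters (seq s i) ++ pair 1 D h :: letters q) 1)
    (oneValue k gen i s D q)

end Values

section Moves

variable {k : Type*} [Field k] {Λ : Type*} [Ring Λ] [Algebra k Λ] {gen : ℕ → Λ} {i : ℕ → ℕ}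

/-- The eventual value of the contraction of two adjacent letters of a tuple of letters. -/
theorem ev_contract (H : ReducesBy k gen) {s a b : ℕ} (hZ : ZeroMoves k gen i s)
    (hO : OneMoves k gen i s) (q : List ℕ) (hab : 2 ≤ a + b) (hq : 3 ≤ a + b ∨ q = []) :
    Ev k gen
      (contract obstructions k gen (letters (seq s i) ++ letter a :: letter b :: letters q) s)
      (((a : k) * b / ((a : k) + b - 1)) • oneValue k gen i s (a + b - 1) q
      + (-(((a : k) - 1) * ((b : k) - 1) / ((a : k) + b - 1))) • zeroValue k gen i s (a + b) q
      + ((a : k) * ((a : k) - 1) / ((a : k) + b - 1)) •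
          chainOrZero Λ (seq s i ++ (a + b - 1) :: q)) := by
  have h := contract_letters H (letters (seq s i)) (letters q) hab (not_obs_one (by omega))
  rw [length_letters, length_seq] at h
  rw [h]
  refine (((hO _ _ _ ?_).scalar _).add ((hZ _ _).scalar _)).add (Ev.scalar _ ?_)
  · exact hq.imp (by omega) id
  · simpa using Ev.letters (k := k) (gen := gen) (seq s i ++ (a + b - 1) :: q)

/-- In `δ'[i 1|…|i s|R]`, if the letters `R` do not form a chain, then in front of `R` only the
contraction which involves the first letter of `R` contributes to the eventual value. -/
theorem ev_front (H : ReducesBy k gen) {s : ℕ} (hi : ∀ t, 1 ≤ t → t ≤ s + 1 → 2 ≤ i t)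
    (hZ : ∀ s' < s, ZeroMoves k gen i s') (hO : ∀ s' < s, OneMoves k gen i s') {R : List ℕ}
    (hR : ¬ R.IsChain Obs) {y : Bar obstructions Λ}
    (hy : Ev k gen (contract obstructions k gen (letters (seq (s + 1) i ++ R)) s) y) :
    Ev k gen (front k gen (letters (seq (s + 1) i ++ R)) (s + 1)) ((-1 : k) ^ (s + 1) • y) := by
  rw [front_succ]
  rw [← zero_add ((-1 : k) ^ (s + 1) • y)]
  refine Ev.add ?_ (hy.scalar _)
  unfold front
  rw [← add_zero (0 : Bar obstructions Λ)]
  refine Ev.add ?_ ?_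
  · rw [seq_succ', List.cons_append, letters_cons]
    have h := (Ev.letters_zero (k := k) (gen := gen) (not_isChain_append hR :
      ¬ (seq s (fun t => i (t + 1)) ++ R).IsChain Obs)).smul (gen (i 1))
    simpa [wordValue] using h
  · rw [← Finset.sum_const_zero (s := Finset.range s)]
    refine Ev.sum _ fun j hj => ?_
    rw [Finset.mem_range] at hj
    obtain ⟨b, rfl⟩ : ∃ b, s = j + 1 + b := ⟨s - (j + 1), by omega⟩
    rw [show j + 1 + b + 1 = j + 2 + b by omega, seq_add_two, List.append_assoc,
      List.cons_append, List.cons_append, letters_append, letters_cons, letters_cons]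
    have h1 := hi (j + 1) (by omega) (by omega)
    have h2 := hi (j + 2) (by omega) (by omega)
    have h := ev_contract H (hZ j hj) (hO j hj) (seq b (fun t => i (j + 2 + t)) ++ R)
      (a := i (j + 1)) (b := i (j + 2)) (by omega) (Or.inl (by omega))
    have hn : ∀ x : ℕ, ¬ (x :: (seq b (fun t => i (j + 2 + t)) ++ R)).IsChain Obs := fun x =>
      not_isChain_append (xs := x :: seq b (fun t => i (j + 2 + t))) hR
    rw [oneValue_eq_zero k gen i j (hn _), zeroValue_eq_zero k gen i j (hn _),
      chainOrZero_of_not Λ (not_isChain_append (hn _))] at h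
    simpa using h.scalar ((-1 : k) ^ (j + 1))

theorem front_zero (x : ℕ) (R : List ℕ) :
    front k gen (letters (x :: R)) 0 = gen x • Finsupp.single (letters R) 1 := by
  simp [front, wordValue]

/-- Splitting `[i 1|…|i s|v(0)v(E)|q]` gives the letters `0|E`, which are not a chain, so that only
the contraction of `i s` with `0` remains. -/
theorem zeroMoves_step (H : ReducesBy k gen) {s : ℕ} (hi : ∀ t, 1 ≤ t → t ≤ s → 2 ≤ i t)
    (hZ : ∀ s' < s, ZeroMoves k gen i s') (hO : ∀ s' < s, OneMoves k gen i s') :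
    ZeroMoves k gen i s := by
  intro E q
  have hR : ¬ (0 :: E :: q).IsChain Obs := not_isChain_append_cons_cons (xs := []) (not_obs_zero E)
  refine Ev.split H _ (isChain_seq_append hi (List.isChain_singleton _)) _ ?_ fun j => ?_
  · rw [length_seq, ← letters_cons, ← letters_cons, ← letters_append]
    cases s with
    | zero =>
      rw [seq_zero, List.nil_append, front_zero]
      simpa [zeroValue] using (Ev.letters (k := k) (gen := gen) (E :: q)).smul (gen 0)
    | succ s =>
      refine ev_front H hi (fun s' hs' => hZ s' (by omega)) (fun s' hs' => hO s' (by omega)) hR ?_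
      have h := contract_zero H (letters (seq s i)) (letters (E :: q)) (i (s + 1))
      rw [length_letters, length_seq] at h
      rw [seq_succ, List.append_assoc, List.singleton_append, letters_append, letters_cons,
        letters_cons, h, zeroValue_succ]
      refine (hZ s (by omega) _ _).add (Ev.scalar _ ?_)
      simpa using Ev.letters (k := k) (gen := gen) (seq s i ++ (i (s + 1) - 1) :: E :: q)
  · have h := deltaTwo_contract_eq_zero (k := k) (gen := gen) (xs := seq s i ++ [0])
      (fun x => by
        rw [List.append_assoc]
        exact not_isChain_append_cons_cons (not_obs_zero x))
      (letter E :: letters q) (j := s + 1 + j) (by simp)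
    rw [length_seq]
    exact Ev.of_eq_zero (by simpa using h)

/-- The tuples `[i 1|…|i s|v(1)|v(0)v(E)|q]` have eventual value `0`. They split into
`[i 1|…|i s|1|0|E|q]`; both the contraction of `i s` with `1` and that of `1` with `0` lead to
tuples whose eventual values contain the forbidden pairs `0|E` or `1|E`. -/
theorem ev_one_pair_zero (H : ReducesBy k gen) {s : ℕ} (hi : ∀ t, 1 ≤ t → t ≤ s → 2 ≤ i t)
    (hZ : ∀ s' ≤ s, ZeroMoves k gen i s') (hO : ∀ s' < s, OneMoves k gen i s') {E : ℕ}
    (hE : E ≠ 0) (q : List ℕ) :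
    Ev k gen (Finsupp.single (letters (seq s i) ++
      letter 1 :: pair 0 E (not_obs_zero E) :: letters q) 1) 0 := by
  have hR : ¬ (1 :: 0 :: E :: q).IsChain Obs :=
    not_isChain_append_cons_cons (xs := [1]) (not_obs_zero E)
  have hR' : ¬ (0 :: E :: q).IsChain Obs := not_isChain_append_cons_cons (xs := []) (not_obs_zero E)
  have hE' : ¬ (1 :: E :: q).IsChain Obs := not_isChain_append_cons_cons (xs := []) (not_obs_one hE)
  have h10 : ([1, 0] : List ℕ).IsChain Obs := by simp [Obs]
  have key := Ev.split H (xs := seq s i ++ [1]) (not_obs_zero E)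
    (by rw [List.append_assoc]; exact isChain_seq_append hi h10) (letters q) (y := 0) ?_ fun j => ?_
  · simpa using key
  · rw [smul_zero, List.length_append, length_seq, List.length_singleton, ← letters_cons,
      ← letters_cons, ← letters_append, List.append_assoc, List.singleton_append, front_succ,
      ← add_zero (0 : Bar obstructions Λ)]
    refine Ev.add ?_ ?_
    · cases s with
      | zero =>
        rw [seq_zero, List.nil_append, front_zero]
        simpa using (Ev.letters_zero (k := k) (gen := gen) hR').smul (gen 1)
      | succ s =>
        have hs := hi (s + 1) (by omega) le_rfl
        suffices hc : Ev k gen (contract obstructions k gen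
            (letters (seq (s + 1) i ++ 1 :: 0 :: E :: q)) s) 0 by
          simpa only [smul_zero] using ev_front H hi (fun s' hs' => hZ s' (by omega))
            (fun s' hs' => hO s' (by omega)) hR hc
        have h := contract_one H (letters (seq s i)) (letters (0 :: E :: q)) hs
          (not_obs_one (by omega))
        rw [length_letters, length_seq] at h
        rw [seq_succ, List.append_assoc, List.singleton_append, letters_append, letters_cons,
          letters_cons, h]
        have h1 := hO s (by omega) (i (s + 1)) (not_obs_one (by omega)) (0 :: E :: q) (Or.inl hs)
        rw [oneValue_eq_zero k gen i s (show ¬ (i (s + 1) :: 0 :: E :: q).IsChain Obs from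
          not_isChain_append (xs := [i (s + 1)]) hR')] at h1
        have h2 := (Ev.letters_zero (k := k) (gen := gen) (not_isChain_append
          (xs := seq s i ++ [i (s + 1)]) hR')).scalar ((i (s + 1) : k) - 1)
        simpa using h1.add h2
    · have h := contract_zero H (letters (seq s i)) (letters (E :: q)) 1
      rw [length_letters, length_seq] at h
      rw [letters_append, letters_cons, letters_cons, h]
      have h1 := hZ s le_rfl 1 (E :: q)
      rw [zeroValue_eq_zero k gen i s hE'] at h1
      have h2 := (Ev.letters_zero (k := k) (gen := gen) (not_isChain_append
          (xs := seq s i) hR')).scalar ((1 : ℕ) : k)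
      simpa using (h1.add h2).scalar ((-1 : k) ^ (s + 1))
  · have h := deltaTwo_contract_eq_zero (k := k) (gen := gen) (xs := seq s i ++ [1, 0])
      (fun x => by
        rw [List.append_assoc]
        exact not_isChain_append (not_isChain_append_cons_cons (xs := [1]) (not_obs_zero x)))
      (letter E :: letters q) (j := s + 1 + 1 + j) (by simp)
    exact Ev.of_eq_zero (by simpa using h)

/-- Splitting `[i 1|…|i s|v(1)v(D)|q]` gives the letters `1|D`, which are not a chain. Besides the
contraction of `i s` with `1`, only the one of `D` with the first letter of `q` could contribute: it
contains tuples which split again, of eventual value zero. -/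
theorem oneMoves_step (H : ReducesBy k gen) {s : ℕ} (hi : ∀ t, 1 ≤ t → t ≤ s → 2 ≤ i t)
    (hZ : ∀ s' ≤ s, ZeroMoves k gen i s') (hO : ∀ s' < s, OneMoves k gen i s') :
    OneMoves k gen i s := by
  intro D hD q hq
  have hR : ¬ (1 :: D :: q).IsChain Obs := not_isChain_append_cons_cons (xs := []) hD
  have hD0 : D ≠ 0 := fun h => hD (Or.inl ⟨rfl, h⟩)
  refine Ev.split H _ (isChain_seq_append hi (List.isChain_singleton _)) _ ?_ fun j => ?_
  · rw [length_seq, ← letters_cons, ← letters_cons, ← letters_append]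
    cases s with
    | zero =>
      rw [seq_zero, List.nil_append, front_zero]
      simpa [oneValue] using (Ev.letters (k := k) (gen := gen) (D :: q)).smul (gen 1)
    | succ s =>
      have hs := hi (s + 1) (by omega) le_rfl
      refine ev_front H hi (fun s' hs' => hZ s' (by omega)) (fun s' hs' => hO s' (by omega)) hR ?_
      have h := contract_one H (letters (seq s i)) (letters (D :: q)) hs (not_obs_one (by omega))
      rw [length_letters, length_seq] at h
      rw [seq_succ, List.append_assoc, List.singleton_append, letters_append, letters_cons,
        letters_cons, h, oneValue_succ]
      refine (hO s (by omega) _ _ _ (Or.inl hs)).add (Ev.scalar _ ?_)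
      simpa using Ev.letters (k := k) (gen := gen) (seq s i ++ i (s + 1) :: D :: q)
  · rw [length_seq]
    cases j with
    | zero =>
      cases q with
      | nil =>
        rw [contract_eq_zero_of_length_le (by simp)]
        exact Ev.zero
      | cons b q =>
        have hD2 : 2 ≤ D := by simpa using hq
        have h := contract_letters H (letters (seq s i ++ [1])) (letters q) (a := D) (b := b)
          (by omega) (not_obs_one (by omega))
        have hdead : Ev k gen (Finsupp.single (letters (seq s i ++ [1]) ++
            pair 1 (D + b - 1) (not_obs_one (by omega)) :: letters q) 1) 0 :=
          Ev.of_eq_zero (deltaTwo_eq_zero k gen (pair_val _) (by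
            rw [List.append_assoc]
            exact not_isChain_append_cons_cons (not_obs_one one_ne_zero)) _)
        have hC := ev_one_pair_zero H hi hZ hO (E := D + b) (by omega) q
        have hL := Ev.letters_zero (k := k) (gen := gen)
          (xs := seq s i ++ 1 :: (D + b - 1) :: q)
          (not_isChain_append_cons_cons (not_obs_one (by omega)))
        have hsum := ((hdead.scalar ((D : k) * b / ((D : k) + b - 1))).add
          (hC.scalar (-(((D : k) - 1) * ((b : k) - 1) / ((D : k) + b - 1))))).add
          (hL.scalar ((D : k) * ((D : k) - 1) / ((D : k) + b - 1)))
        rw [smul_zero, smul_zero, smul_zero, add_zero, add_zero] at hsum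
        simp only [letters_append, List.append_assoc, letters_cons, letters_nil,
          List.singleton_append, List.length_append, length_letters, length_seq,
          List.length_singleton] at h hsum
        rw [letters_cons, add_zero, h]
        exact hsum
    | succ j =>
      have h := deltaTwo_contract_eq_zero (k := k) (gen := gen) (xs := seq s i ++ [1, D])
        (fun x => by
          rw [List.append_assoc]
          exact not_isChain_append_cons_cons hD)
        (letters q) (j := s + 1 + (j + 1)) (by simp; omega)
      exact Ev.of_eq_zero (by simpa using h)

theorem zeroMoves_and_oneMoves (H : ReducesBy k gen) (s : ℕ) (hi : ∀ t, 1 ≤ t → t ≤ s → 2 ≤ i t) :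
    ZeroMoves k gen i s ∧ OneMoves k gen i s := by
  induction s using Nat.strong_induction_on with
  | _ s ih =>
    have ih' : ∀ s' < s, ZeroMoves k gen i s' ∧ OneMoves k gen i s' := fun s' hs' =>
      ih s' hs' fun t h1 h2 => hi t h1 (by omega)
    have hZ := zeroMoves_step H hi (fun s' hs' => (ih' s' hs').1) fun s' hs' => (ih' s' hs').2
    refine ⟨hZ, oneMoves_step H hi (fun s' hs' => ?_) fun s' hs' => (ih' s' hs').2⟩
    rcases hs'.lt_or_eq with h | rfl
    · exact (ih' s' h).1
    · exact hZ

end Moves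

/-! ### The Anick differential -/

section Differential

variable (k : Type*) [Field k] {Λ : Type*} [Ring Λ] [Algebra k Λ] (gen : ℕ → Λ)

theorem tuple_eq_letters (n : ℕ) (i : ℕ → ℕ) : tuple n i = letters (seq n i) := by
  rw [tuple, letters, seq, List.map_map]; rfl

/-- The element `[i 1|…|i n]` over an arbitrary algebra; it is `0` if the tuple is not a chain. -/
noncomputable def bracket (Λ : Type*) [Ring Λ] (n : ℕ) (i : ℕ → ℕ) :
    AnickModule obstructions Λ n :=
  if h : IsChainTuple obstructions (tuple n i) then
    Finsupp.single ⟨tuple n i, by simp [tuple], h⟩ 1 else 0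

theorem inclusion_bracket (n : ℕ) (i : ℕ → ℕ) :
    inclusion obstructions Λ n (bracket Λ n i) = chainOrZero Λ (seq n i) := by
  rw [bracket, chainOrZero]
  have hiff : IsChainTuple obstructions (tuple n i) ↔ (seq n i).IsChain Obs := by
    rw [tuple_eq_letters, isChainTuple_letters]
  by_cases h : IsChainTuple obstructions (tuple n i)
  · rw [dif_pos h, if_pos (hiff.1 h), ← tuple_eq_letters]
    exact Finsupp.mapDomain_single
  · rw [dif_neg h, if_neg fun h' => h (hiff.2 h'), map_zero]

theorem inclusion_injective (n : ℕ) : Function.Injective (inclusion obstructions Λ n) :=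
  Finsupp.mapDomain_injective Subtype.val_injective

theorem anickDifferential_single {n : ℕ} {c : Chain obstructions (n + 1)}
    {y : AnickModule obstructions Λ n} (h : IsEventualValue obstructions k gen c y) :
    anickDifferential obstructions k gen n (Finsupp.single c 1) = y := by
  have hex : ∃ y, IsEventualValue obstructions k gen c y := ⟨y, h⟩
  rw [anickDifferential, Finsupp.linearCombination_single, one_smul, dif_pos hex]
  obtain ⟨K, hK⟩ := hex.choose_spec
  obtain ⟨K', hK'⟩ := h
  apply inclusion_injective
  rw [← hK _ (le_max_left K K'), hK' _ (le_max_right K K')]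

variable {k gen}

/-- The eventual value determines the differential of a chain of letters. -/
theorem anickDifferential_bracket {n : ℕ} {i : ℕ → ℕ} (hc : (seq (n + 1) i).IsChain Obs)
    {y : AnickModule obstructions Λ n}
    (h : Ev k gen (deltaOneBasis obstructions k gen (letters (seq (n + 1) i)))
      (inclusion obstructions Λ n y)) :
    anickDifferential obstructions k gen n (bracket Λ (n + 1) i) = y := by
  rw [bracket, dif_pos (by rwa [tuple_eq_letters, isChainTuple_letters])]
  apply anickDifferential_single
  rw [← tuple_eq_letters] at h
  exact h

theorem sum_range_succ_eq_sum_Icc {M : Type*} [AddCommMonoid M] (f : ℕ → M) (n : ℕ) :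
    ∑ j ∈ Finset.range n, f (j + 1) = ∑ j ∈ Finset.Icc 1 n, f j := by
  induction n with
  | zero => rfl
  | succ n ih => rw [Finset.sum_range_succ, Finset.sum_Icc_succ_top (by omega), ih]

theorem sum_Icc_two {M : Type*} [AddCommMonoid M] {f : ℕ → M} (n : ℕ) (h : f 1 = 0) :
    ∑ j ∈ Finset.Icc 2 n, f j = ∑ j ∈ Finset.Icc 1 n, f j := by
  refine Finset.sum_subset (Finset.Icc_subset_Icc_left (by omega)) fun j hj hj' => ?_
  rw [Finset.mem_Icc] at hj hj'
  rw [show j = 1 by omega, h]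

theorem seq_merge {n j c : ℕ} (i : ℕ → ℕ) (h1 : 1 ≤ j) (hj : j ≤ n) :
    seq n (merge i j c) = seq (j - 1) i ++ c :: seq (n - j) fun t => i (j + 1 + t) := by
  obtain ⟨a, rfl⟩ : ∃ a, j = a + 1 := ⟨j - 1, by omega⟩
  obtain ⟨b, rfl⟩ : ∃ b, n = a + 1 + b := ⟨n - (a + 1), by omega⟩
  rw [seq_add, seq_succ, Nat.add_sub_cancel, Nat.add_sub_cancel_left, List.append_assoc]
  congr 1
  · exact seq_congr fun t _ ht => by simp [merge, show t < a + 1 by omega]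
  · simp only [List.singleton_append, List.cons.injEq]
    refine ⟨by simp [merge], seq_congr fun t h1 _ => ?_⟩
    simp only [merge, show ¬ a + 1 + t < a + 1 by omega, show ¬ a + 1 + t = a + 1 by omega,
      if_false]
    congr 1
    omega

theorem seq_merge_dec {n j t c : ℕ} (i : ℕ → ℕ) (ht : t < j) (h1 : 1 ≤ j) (hj : j ≤ n) :
    seq n (merge (dec i t) j c) =
      seq (j - 1) (dec i t) ++ c :: seq (n - j) fun t => i (j + 1 + t) := by
  rw [seq_merge _ h1 hj]
  congr 2
  exact seq_congr fun u _ _ => by rw [dec, Function.update_of_ne (by omega)]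

theorem seq_eq_cons_cons {n j : ℕ} (i : ℕ → ℕ) (h1 : 1 ≤ j) (hj : j ≤ n) :
    seq (n + 1) i = seq (j - 1) i ++ i j :: i (j + 1) :: seq (n - j) fun t => i (j + 1 + t) := by
  obtain ⟨a, rfl⟩ : ∃ a, j = a + 1 := ⟨j - 1, by omega⟩
  obtain ⟨b, rfl⟩ : ∃ b, n = a + 1 + b := ⟨n - (a + 1), by omega⟩
  rw [show a + 1 + b + 1 = a + 2 + b by omega, seq_add_two, Nat.add_sub_cancel,
    Nat.add_sub_cancel_left]

theorem deltaOneBasis_letters (n : ℕ) (i : ℕ → ℕ) :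
    deltaOneBasis obstructions k gen (letters (seq (n + 1) i)) =
      gen (i 1) • Finsupp.single (letters (seq n fun t => i (t + 1))) 1 +
      ∑ j ∈ Finset.Icc 1 n, (-1 : k) ^ j •
        contract obstructions k gen (letters (seq (n + 1) i)) (j - 1) := by
  rw [deltaOneBasis_eq (k := k) (gen := gen) (s := n) (d := 0) (by simp), Finset.sum_range_zero,
    add_zero, ← sum_range_succ_eq_sum_Icc]
  unfold front
  congr 1
  rw [seq_succ']
  simp [wordValue]

/-- The eventual value of the contraction of the entries `i j` and `i (j+1)` of a chain. -/
noncomputable def contractValue (k : Type*) [Field k] {Λ : Type*} [Ring Λ] [Algebra k Λ]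
    (gen : ℕ → Λ) (n : ℕ) (i : ℕ → ℕ) (j : ℕ) : AnickModule obstructions Λ n :=
  ((i j : k) * (i (j + 1) : k) / ((i j : k) + (i (j + 1) : k) - 1)) •
      (gen 1 • bracket Λ n (merge i j (i j + i (j + 1) - 1)) + ∑ t ∈ Finset.Icc 1 (j - 1),
        ((i t : k) - 1) • bracket Λ n (merge i j (i j + i (j + 1) - 1)))
    + (-(((i j : k) - 1) * ((i (j + 1) : k) - 1) / ((i j : k) + (i (j + 1) : k) - 1))) •
      (gen 0 • bracket Λ n (merge i j (i j + i (j + 1))) + ∑ t ∈ Finset.Icc 1 (j - 1),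
        (i t : k) • bracket Λ n (merge (dec i t) j (i j + i (j + 1))))
    + ((i j : k) * ((i j : k) - 1) / ((i j : k) + (i (j + 1) : k) - 1)) •
      bracket Λ n (merge i j (i j + i (j + 1) - 1))

theorem inclusion_smul (n : ℕ) (r : k) (x : AnickModule obstructions Λ n) :
    inclusion obstructions Λ n (r • x) = r • inclusion obstructions Λ n x :=
  LinearMap.map_smul_of_tower _ _ _

theorem inclusion_oneValue {n j c : ℕ} (i : ℕ → ℕ) (h1 : 1 ≤ j) (hj : j ≤ n) :
    inclusion obstructions Λ n (gen 1 • bracket Λ n (merge i j c) + ∑ t ∈ Finset.Icc 1 (j - 1),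
        ((i t : k) - 1) • bracket Λ n (merge i j c)) =
      oneValue k gen i (j - 1) c (seq (n - j) fun t => i (j + 1 + t)) := by
  simp only [map_add, map_sum, inclusion_smul, map_smul, inclusion_bracket, oneValue,
    seq_merge i h1 hj]

theorem inclusion_zeroValue {n j c : ℕ} (i : ℕ → ℕ) (h1 : 1 ≤ j) (hj : j ≤ n) :
    inclusion obstructions Λ n (gen 0 • bracket Λ n (merge i j c) + ∑ t ∈ Finset.Icc 1 (j - 1),
        (i t : k) • bracket Λ n (merge (dec i t) j c)) =
      zeroValue k gen i (j - 1) c (seq (n - j) fun t => i (j + 1 + t)) := by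
  simp only [map_add, map_sum, inclusion_smul, map_smul, inclusion_bracket, zeroValue,
    seq_merge i h1 hj]
  congr 1
  refine Finset.sum_congr rfl fun t ht => ?_
  rw [Finset.mem_Icc] at ht
  rw [seq_merge_dec i (by omega) h1 hj]

theorem ev_contractValue (H : ReducesBy k gen) {n j : ℕ} {i : ℕ → ℕ} (h1 : 1 ≤ j) (hj : j ≤ n)
    (hi : ∀ t, 1 ≤ t → t ≤ j → 2 ≤ i t) (hj' : j < n → 2 ≤ i (j + 1)) :
    Ev k gen (contract obstructions k gen (letters (seq (n + 1) i)) (j - 1))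
      (inclusion obstructions Λ n (contractValue k gen n i j)) := by
  have hij := hi j h1 le_rfl
  obtain ⟨hZ, hO⟩ := zeroMoves_and_oneMoves H (j - 1) fun t h h' => hi t h (by omega)
  have h := ev_contract H hZ hO (seq (n - j) fun t => i (j + 1 + t)) (a := i j) (b := i (j + 1))
    (by omega) (by
      rcases hj.lt_or_eq with hlt | rfl
      · have := hj' hlt
        exact Or.inl (by omega)
      · exact Or.inr (by simp))
  rw [contractValue, map_add, map_add, inclusion_smul, inclusion_smul, inclusion_smul,
    inclusion_oneValue i h1 hj, inclusion_zeroValue i h1 hj, inclusion_bracket, seq_merge i h1 hj,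
    seq_eq_cons_cons i h1 hj, letters_append, letters_cons, letters_cons]
  exact h

/-- The contribution of one contraction to the differential, with all scalars collected. -/
theorem neg_one_pow_smul_contractValue (n : ℕ) (i : ℕ → ℕ) (j : ℕ) :
    (-1 : k) ^ j • contractValue k gen n i j =
      ((-1 : k) ^ j * ((i j : k) * (i (j + 1) : k) / ((i j : k) + (i (j + 1) : k) - 1))) •
        gen 1 • bracket Λ n (merge i j (i j + i (j + 1) - 1))
      + ∑ t ∈ Finset.Icc 1 (j - 1),
        ((-1 : k) ^ j * ((i j : k) * (i (j + 1) : k) / ((i j : k) + (i (j + 1) : k) - 1))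
            * ((i t : k) - 1)) • bracket Λ n (merge i j (i j + i (j + 1) - 1))
      + ((-1 : k) ^ j * ((i j : k) * ((i j : k) - 1) / ((i j : k) + (i (j + 1) : k) - 1))) •
        bracket Λ n (merge i j (i j + i (j + 1) - 1))
      + ∑ t ∈ Finset.Icc 1 (j - 1),
        ((-1 : k) ^ (j + 1) * (i t : k)
            * (((i j : k) - 1) * ((i (j + 1) : k) - 1) / ((i j : k) + (i (j + 1) : k) - 1))) •
          bracket Λ n (merge (dec i t) j (i j + i (j + 1)))
      + ((-1 : k) ^ (j + 1) * (((i j : k) - 1) * ((i (j + 1) : k) - 1)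
            / ((i j : k) + (i (j + 1) : k) - 1))) •
        gen 0 • bracket Λ n (merge i j (i j + i (j + 1))) := by
  rw [contractValue]
  generalize (i j : k) * (i (j + 1) : k) / ((i j : k) + (i (j + 1) : k) - 1) = α
  generalize ((i j : k) - 1) * ((i (j + 1) : k) - 1) / ((i j : k) + (i (j + 1) : k) - 1) = β
  generalize (i j : k) * ((i j : k) - 1) / ((i j : k) + (i (j + 1) : k) - 1) = γ
  have e1 : ∑ t ∈ Finset.Icc 1 (j - 1), ((-1 : k) ^ j * α * ((i t : k) - 1)) •
      bracket Λ n (merge i j (i j + i (j + 1) - 1)) = ((-1 : k) ^ j * α) •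
      ∑ t ∈ Finset.Icc 1 (j - 1), ((i t : k) - 1) •
        bracket Λ n (merge i j (i j + i (j + 1) - 1)) := by
    rw [Finset.smul_sum]
    exact Finset.sum_congr rfl fun t _ => by rw [smul_smul]
  have e2 : ∑ t ∈ Finset.Icc 1 (j - 1), ((-1 : k) ^ (j + 1) * (i t : k) * β) •
      bracket Λ n (merge (dec i t) j (i j + i (j + 1))) = ((-1 : k) ^ (j + 1) * β) •
      ∑ t ∈ Finset.Icc 1 (j - 1), (i t : k) •
        bracket Λ n (merge (dec i t) j (i j + i (j + 1))) := by
    rw [Finset.smul_sum]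
    exact Finset.sum_congr rfl fun t _ => by rw [smul_smul, mul_right_comm]
  rw [e1, e2]
  generalize gen 1 • bracket Λ n (merge i j (i j + i (j + 1) - 1)) = A
  generalize gen 0 • bracket Λ n (merge i j (i j + i (j + 1))) = B
  generalize (∑ t ∈ Finset.Icc 1 (j - 1), ((i t : k) - 1) •
        bracket Λ n (merge i j (i j + i (j + 1) - 1))) = A'
  generalize (∑ t ∈ Finset.Icc 1 (j - 1), (i t : k) •
        bracket Λ n (merge (dec i t) j (i j + i (j + 1)))) = B'
  module

theorem ev_first (n : ℕ) (i : ℕ → ℕ) :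
    Ev k gen (gen (i 1) • Finsupp.single (letters (seq n fun t => i (t + 1))) 1)
      (inclusion obstructions Λ n (gen (i 1) • bracket Λ n fun t => i (t + 1))) := by
  rw [map_smul, inclusion_bracket]
  exact (Ev.letters _).smul _

/-- The eventual value of `δ'[i 1|…|i (n+1)]` with `i 1, …, i n ≥ 2`. -/
theorem ev_regular (H : ReducesBy k gen) (n : ℕ) {i : ℕ → ℕ} (hi : ∀ j, 1 ≤ j → j ≤ n → 2 ≤ i j) :
    Ev k gen (deltaOneBasis obstructions k gen (letters (seq (n + 1) i)))
      (inclusion obstructions Λ n ((gen (i 1) • bracket Λ n fun t => i (t + 1)) +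
        ∑ j ∈ Finset.Icc 1 n, (-1 : k) ^ j • contractValue k gen n i j)) := by
  rw [deltaOneBasis_letters, map_add, map_sum]
  refine (ev_first n i).add (Ev.sum _ fun j hj => ?_)
  rw [Finset.mem_Icc] at hj
  rw [inclusion_smul]
  exact (ev_contractValue H hj.1 hj.2 (fun t h h' => hi t h (by omega))
    fun h => hi _ (by omega) (by omega)).scalar _

/-- The eventual value of `δ'[i 1|…|i (n+1)|1|0]` with `i 1, …, i (n+1) ≥ 2`. -/
theorem ev_one_zero (H : ReducesBy k gen) (n : ℕ) {i : ℕ → ℕ}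
    (hi : ∀ j, 1 ≤ j → j ≤ n + 1 → 2 ≤ i j) (h1 : i (n + 2) = 1) (h0 : i (n + 3) = 0) :
    Ev k gen (deltaOneBasis obstructions k gen (letters (seq (n + 2 + 1) i)))
      (inclusion obstructions Λ (n + 2) ((gen (i 1) • bracket Λ (n + 2) fun t => i (t + 1)) +
        (∑ j ∈ Finset.Icc 1 n, (-1 : k) ^ j • contractValue k gen (n + 2) i j
        + (-1 : k) ^ (n + 1) • (gen 1 • bracket Λ (n + 2) (merge i (n + 2) 0)
          + ∑ t ∈ Finset.Icc 1 (n + 1), ((i t : k) - 1) • bracket Λ (n + 2) (merge i (n + 2) 0))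
        + (-1 : k) ^ (n + 2) • ((gen 0 • bracket Λ (n + 2) (merge i (n + 2) 1)
          + ∑ t ∈ Finset.Icc 1 (n + 1),
              (i t : k) • bracket Λ (n + 2) (merge (dec i t) (n + 2) 1))
          + bracket Λ (n + 2) (merge i (n + 2) 0))))) := by
  rw [deltaOneBasis_letters, map_add, Finset.sum_Icc_succ_top (by omega),
    Finset.sum_Icc_succ_top (by omega), map_add, map_add, map_sum]
  refine (ev_first _ i).add (((Ev.sum _ fun j hj => ?_).add ?_).add ?_)
  · rw [Finset.mem_Icc] at hj
    rw [inclusion_smul]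
    exact (ev_contractValue H hj.1 (by omega) (fun t h h' => hi t h (by omega))
      fun h => hi _ (by omega) (by omega)).scalar _
  · have hn := hi (n + 1) (by omega) le_rfl
    have hO := (zeroMoves_and_oneMoves H n fun t h h' => hi t h (by omega)).2
    have e := inclusion_oneValue (k := k) (gen := gen) (n := n + 2) (j := n + 2) (c := 0) i
      (by omega) le_rfl
    rw [show n + 2 - 1 = n + 1 by omega, Nat.sub_self, seq_zero, oneValue_succ] at e
    rw [inclusion_smul, e, seq_succ, seq_succ, seq_succ, h1, h0]
    refine Ev.scalar _ ?_
    have hc := contract_one H (letters (seq n i)) (letters [0]) hn (not_obs_one (by omega))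
    rw [length_letters, length_seq] at hc
    simp only [Nat.add_sub_cancel, letters_append, List.append_assoc, letters_cons, letters_nil,
      List.cons_append, List.nil_append] at hc ⊢
    rw [hc]
    refine (hO _ _ [0] (Or.inl hn)).add (Ev.scalar _ ?_)
    simpa using Ev.letters (k := k) (gen := gen) (seq n i ++ [i (n + 1), 0])
  · have hZ := (zeroMoves_and_oneMoves H (n + 1) hi).1
    have e := inclusion_zeroValue (k := k) (gen := gen) (n := n + 2) (j := n + 2) (c := 1) i
      (by omega) le_rfl
    rw [show n + 2 - 1 = n + 1 by omega, Nat.sub_self, seq_zero] at e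
    rw [inclusion_smul, map_add, e, inclusion_bracket, seq_merge i (by omega) le_rfl, seq_succ,
      seq_succ _ i, h1, h0]
    refine Ev.scalar _ ?_
    have hc := contract_zero H (letters (seq (n + 1) i)) (letters []) 1
    rw [length_letters, length_seq] at hc
    simp only [show n + 2 - 1 = n + 1 by omega, Nat.sub_self, seq_zero, letters_append,
      List.append_assoc, letters_cons, letters_nil, List.singleton_append, Nat.cast_one,
      one_smul] at hc ⊢
    rw [hc]
    refine (hZ 1 []).add ?_
    have h := Ev.letters (k := k) (gen := gen) (seq (n + 1) i ++ [0])
    rw [letters_append] at h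
    exact h

/-- The eventual value of `δ'[1|0]`. -/
theorem ev_one_zero_pair (H : ReducesBy k gen) {i : ℕ → ℕ} (h1 : i 1 = 1) (h0 : i 2 = 0) :
    Ev k gen (deltaOneBasis obstructions k gen (letters (seq 2 i)))
      (inclusion obstructions Λ 1 (gen 1 • bracket Λ 1 (fun _ => 0)
        - gen 0 • bracket Λ 1 (fun _ => 1) - bracket Λ 1 fun _ => 0)) := by
  have hZ := (zeroMoves_and_oneMoves H 0 (i := i) fun t h h' => by omega).1 1 []
  have hc := contract_zero H (letters []) (letters []) 1
  have hL := fun x => Ev.letters (k := k) (gen := gen) [x]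
  have hs : seq 2 i = [1, 0] := by simp [seq, List.range_succ, h1, h0]
  have hs' : ∀ f : ℕ → ℕ, seq 1 f = [f 1] := fun f => by simp [seq]
  rw [deltaOneBasis_letters, map_sub, map_sub, map_smul, map_smul, inclusion_bracket,
    inclusion_bracket, sub_sub, sub_eq_add_neg, hs, hs', hs', hs']
  simp only [zeroValue, seq_zero, List.nil_append, letters_nil, letters_cons, List.length_nil,
    Nat.cast_one, one_smul, Finset.Icc_self, Finset.sum_singleton, h1, h0, pow_one,
    Nat.sub_self, neg_smul, one_add_one_eq_two] at hZ hc hL ⊢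
  refine ((hL 0).smul (gen 1)).add ?_
  rw [hc]
  simpa using ((hL 0).add hZ).scalar (-1 : k)

end Differential

/-! ### The classification of the chains and the closed formulas -/

theorem isChain_regular {n : ℕ} {i : ℕ → ℕ} (hi : ∀ j, 1 ≤ j → j ≤ n → 2 ≤ i j) :
    (seq (n + 1) i).IsChain Obs := by
  rw [seq_succ]
  exact isChain_seq_append hi (List.isChain_singleton _)

theorem isChain_one_zero {n : ℕ} {i : ℕ → ℕ} (hi : ∀ j, 1 ≤ j → j ≤ n → 2 ≤ i j)
    (h1 : i (n + 1) = 1) (h0 : i (n + 2) = 0) : (seq (n + 2) i).IsChain Obs := by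
  rw [seq_succ, seq_succ, h1, h0, List.append_assoc]
  exact isChain_seq_append hi (by simp [Obs])

/-- The classification of the chains: after a letter `1` only `0` can follow, and nothing can
follow after `0`. -/
theorem exists_tuple_of_chain {n : ℕ} (c : Chain obstructions (n + 1)) : ∃ i : ℕ → ℕ,
    c.1 = tuple (n + 1) i ∧
      ((∀ j, 1 ≤ j → j ≤ n → 2 ≤ i j) ∨
        (1 ≤ n ∧ (∀ j, 1 ≤ j → j ≤ n - 1 → 2 ≤ i j) ∧ i n = 1 ∧ i (n + 1) = 0)) := by
  obtain ⟨l, hl, hc⟩ := c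
  obtain ⟨xs, rfl, hxs⟩ := isChainTuple_iff.1 hc
  rw [length_letters] at hl
  let i : ℕ → ℕ := fun t => xs.getD (t - 1) 0
  have hseq : xs = seq (n + 1) i := by
    refine List.ext_getElem (by simp [hl]) fun j h h' => ?_
    simp [seq, i, List.getElem?_eq_getElem h]
  have hobs : ∀ j, 1 ≤ j → j ≤ n → Obs (i j) (i (j + 1)) := by
    intro j h1 hj
    have h := List.isChain_iff_getElem.1 hxs (j - 1) (by omega)
    simpa [i, List.getElem?_eq_getElem (show j - 1 < xs.length by omega),
      List.getElem?_eq_getElem (show j < xs.length by omega), show j - 1 + 1 = j by omega] using h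
  refine ⟨i, by rw [tuple_eq_letters, ← hseq], ?_⟩
  have hlt : ∀ j, 1 ≤ j → j < n → 2 ≤ i j := by
    intro j h1 hj
    rcases hobs j h1 hj.le with h | h
    · have h' := hobs (j + 1) (by omega) hj
      rw [h.2] at h'
      exact (not_obs_zero _ h').elim
    · exact h
  by_cases hn : ∀ j, 1 ≤ j → j ≤ n → 2 ≤ i j
  · exact Or.inl hn
  · push Not at hn
    obtain ⟨j, h1, hj, hlt2⟩ := hn
    obtain rfl : j = n := by
      by_contra hne
      have := hlt j h1 (by omega)
      omega
    rcases hobs j h1 le_rfl with h | h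
    · exact Or.inr ⟨h1, fun t h1 h2 => hlt t h1 (by omega), h⟩
    · omega

section

variable {k : Type*} [Field k] {Λ : Type*} [Ring Λ] [Algebra k Λ] {gen : ℕ → Λ}

theorem isEventualValue_anickDifferential (H : ReducesBy k gen) {n : ℕ}
    (c : Chain obstructions (n + 1)) : IsEventualValue obstructions k gen c
      (anickDifferential obstructions k gen n (Finsupp.single c 1)) := by
  suffices h : ∃ y, IsEventualValue obstructions k gen c y by
    obtain ⟨y, hy⟩ := h
    rwa [anickDifferential_single k gen hy]
  obtain ⟨i, hc, hi⟩ := exists_tuple_of_chain c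
  rw [tuple_eq_letters] at hc
  have key : ∀ y, Ev k gen (deltaOneBasis obstructions k gen (letters (seq (n + 1) i)))
      (inclusion obstructions Λ n y) → IsEventualValue obstructions k gen c y := by
    intro y hy
    rw [← hc] at hy
    exact hy
  rcases hi with hi | ⟨hn, hi, h1, h0⟩
  · exact ⟨_, key _ (ev_regular H n hi)⟩
  · match n, hn with
    | 1, _ => exact ⟨_, key _ (ev_one_zero_pair H h1 h0)⟩
    | n + 2, _ => exact ⟨_, key _ (ev_one_zero H n (fun j h h' => hi j h (by omega)) h1 h0)⟩

theorem anickDifferential_regular (H : ReducesBy k gen) (n : ℕ) (i : ℕ → ℕ)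
    (hi : ∀ j, 1 ≤ j → j ≤ n → 2 ≤ i j) :
    anickDifferential obstructions k gen n (bracket Λ (n + 1) i) =
        gen (i 1) • bracket Λ n (fun t => i (t + 1))
        + ∑ j ∈ Finset.Icc 1 n,
            ((-1 : k) ^ j * ((i j : k) * (i (j + 1) : k) / ((i j : k) + (i (j + 1) : k) - 1))) •
              gen 1 • bracket Λ n (merge i j (i j + i (j + 1) - 1))
        + ∑ j ∈ Finset.Icc 2 n, ∑ t ∈ Finset.Icc 1 (j - 1),
            ((-1 : k) ^ j * ((i j : k) * (i (j + 1) : k) / ((i j : k) + (i (j + 1) : k) - 1))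
                * ((i t : k) - 1)) •
              bracket Λ n (merge i j (i j + i (j + 1) - 1))
        + ∑ j ∈ Finset.Icc 1 n,
            ((-1 : k) ^ j * ((i j : k) * ((i j : k) - 1) / ((i j : k) + (i (j + 1) : k) - 1))) •
              bracket Λ n (merge i j (i j + i (j + 1) - 1))
        + ∑ j ∈ Finset.Icc 2 n, ∑ t ∈ Finset.Icc 1 (j - 1),
            ((-1 : k) ^ (j + 1) * (i t : k)
                * (((i j : k) - 1) * ((i (j + 1) : k) - 1)
                    / ((i j : k) + (i (j + 1) : k) - 1))) •
              bracket Λ n (merge (dec i t) j (i j + i (j + 1)))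
        + ∑ j ∈ Finset.Icc 1 n,
            ((-1 : k) ^ (j + 1) * (((i j : k) - 1) * ((i (j + 1) : k) - 1)
                / ((i j : k) + (i (j + 1) : k) - 1))) •
              gen 0 • bracket Λ n (merge i j (i j + i (j + 1))) := by
  rw [anickDifferential_bracket (isChain_regular hi) (ev_regular H n hi),
    Finset.sum_congr rfl fun j _ => neg_one_pow_smul_contractValue n i j,
    sum_Icc_two n (by simp), sum_Icc_two n (by simp)]
  simp only [Finset.sum_add_distrib]
  abel

theorem anickDifferential_one_zero (H : ReducesBy k gen) (n : ℕ) (i : ℕ → ℕ) (hn : 2 ≤ n)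
    (hi : ∀ j, 1 ≤ j → j ≤ n - 1 → 2 ≤ i j) (h1 : i n = 1) (h0 : i (n + 1) = 0) :
    anickDifferential obstructions k gen n (bracket Λ (n + 1) i) =
        gen (i 1) • bracket Λ n (fun t => i (t + 1))
        + ∑ j ∈ Finset.Icc 1 (n - 2),
            ((-1 : k) ^ j * ((i j : k) * (i (j + 1) : k) / ((i j : k) + (i (j + 1) : k) - 1))) •
              gen 1 • bracket Λ n (merge i j (i j + i (j + 1) - 1))
        + ∑ j ∈ Finset.Icc 1 (n - 2),
            ((-1 : k) ^ (j + 1) * (((i j : k) - 1) * ((i (j + 1) : k) - 1)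
                / ((i j : k) + (i (j + 1) : k) - 1))) •
              gen 0 • bracket Λ n (merge i j (i j + i (j + 1)))
        + ∑ j ∈ Finset.Icc 1 (n - 2),
            ((-1 : k) ^ j * ((i j : k) * ((i j : k) - 1) / ((i j : k) + (i (j + 1) : k) - 1))) •
              bracket Λ n (merge i j (i j + i (j + 1) - 1))
        + ∑ j ∈ Finset.Icc 2 (n - 2), ∑ t ∈ Finset.Icc 1 (j - 1),
            ((-1 : k) ^ (j + 1) * (i t : k)
                * (((i j : k) - 1) * ((i (j + 1) : k) - 1)
                    / ((i j : k) + (i (j + 1) : k) - 1))) •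
              bracket Λ n (merge (dec i t) j (i j + i (j + 1)))
        + ∑ j ∈ Finset.Icc 2 (n - 2), ∑ t ∈ Finset.Icc 1 (j - 1),
            ((-1 : k) ^ j * ((i t : k) - 1)
                * ((i j : k) * (i (j + 1) : k) / ((i j : k) + (i (j + 1) : k) - 1))) •
              bracket Λ n (merge i j (i j + i (j + 1) - 1))
        + ∑ j ∈ Finset.Icc 1 (n - 1),
            ((-1 : k) ^ n * (i j : k)) • bracket Λ n (merge (dec i j) n 1)
        + ∑ j ∈ Finset.Icc 1 (n - 1),
            ((-1 : k) ^ (n - 1) * ((i j : k) - 1)) • bracket Λ n (merge i n 0)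
        + ((-1 : k) ^ (n - 1)) • gen 1 • bracket Λ n (merge i n 0)
        + ((-1 : k) ^ n) • bracket Λ n (merge i n 0)
        + ((-1 : k) ^ n) • gen 0 • bracket Λ n (merge i n 1) := by
  obtain ⟨n, rfl⟩ : ∃ m, n = m + 2 := ⟨n - 2, by omega⟩
  rw [anickDifferential_bracket (isChain_one_zero (fun j h h' => hi j h (by omega)) h1 h0)
    (ev_one_zero H n (fun j h h' => hi j h (by omega)) h1 h0), Nat.add_sub_cancel,
    show n + 2 - 1 = n + 1 by omega,
    Finset.sum_congr rfl fun j _ => neg_one_pow_smul_contractValue (n + 2) i j,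
    sum_Icc_two n (by simp), sum_Icc_two n (by simp)]
  simp only [Finset.sum_add_distrib, smul_add, Finset.smul_sum, smul_smul (M := k),
    mul_right_comm ((-1 : k) ^ _)]
  abel

end

end U3

theorem mainTheorem7 (k : Type*) [Field k] [CharZero k] :
    -- the reduced words (including the empty one) form a basis of `Λ`
    (LinearIndependent k
        (fun w : {w : List ℕ // Anick.IsReduced U3.obstructions w} =>
          Anick.wordValue (U3.v k) w.1) ∧
      Submodule.span k (Set.range
        (fun w : {w : List ℕ // Anick.IsReduced U3.obstructions w} =>
          Anick.wordValue (U3.v k) w.1)) = ⊤) ∧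
    -- the computation of the differential stabilizes on every chain
    (∀ (n : ℕ) (c : Anick.Chain U3.obstructions (n + 1)),
      Anick.IsEventualValue U3.obstructions k (U3.v k) c
        (U3.delta k n (Finsupp.single c 1))) ∧
    -- every basis chain of `A_{n+1}` is of one of the forms treated below
    (∀ (n : ℕ) (c : Anick.Chain U3.obstructions (n + 1)), ∃ i : ℕ → ℕ,
      c.1 = U3.tuple (n + 1) i ∧
      ((∀ j, 1 ≤ j → j ≤ n → 2 ≤ i j) ∨
        (1 ≤ n ∧ (∀ j, 1 ≤ j → j ≤ n - 1 → 2 ≤ i j) ∧ i n = 1 ∧ i (n + 1) = 0))) ∧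
    -- chains `[i_1|…|i_{n+1}]` with `i_1, …, i_n ≥ 2`
    (∀ (n : ℕ) (i : ℕ → ℕ), (∀ j, 1 ≤ j → j ≤ n → 2 ≤ i j) →
      Anick.IsChainTuple U3.obstructions (U3.tuple (n + 1) i) ∧
      U3.delta k n (U3.br k (n + 1) i) =
        U3.v k (i 1) • U3.br k n (fun t => i (t + 1))
        + ∑ j ∈ Finset.Icc 1 n,
            ((-1 : k) ^ j * ((i j : k) * (i (j + 1) : k) / ((i j : k) + (i (j + 1) : k) - 1))) •
              U3.v k 1 • U3.br k n (U3.merge i j (i j + i (j + 1) - 1))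
        + ∑ j ∈ Finset.Icc 2 n, ∑ t ∈ Finset.Icc 1 (j - 1),
            ((-1 : k) ^ j * ((i j : k) * (i (j + 1) : k) / ((i j : k) + (i (j + 1) : k) - 1))
                * ((i t : k) - 1)) •
              U3.br k n (U3.merge i j (i j + i (j + 1) - 1))
        + ∑ j ∈ Finset.Icc 1 n,
            ((-1 : k) ^ j * ((i j : k) * ((i j : k) - 1) / ((i j : k) + (i (j + 1) : k) - 1))) •
              U3.br k n (U3.merge i j (i j + i (j + 1) - 1))
        + ∑ j ∈ Finset.Icc 2 n, ∑ t ∈ Finset.Icc 1 (j - 1),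
            ((-1 : k) ^ (j + 1) * (i t : k)
                * (((i j : k) - 1) * ((i (j + 1) : k) - 1)
                    / ((i j : k) + (i (j + 1) : k) - 1))) •
              U3.br k n (U3.merge (U3.dec i t) j (i j + i (j + 1)))
        + ∑ j ∈ Finset.Icc 1 n,
            ((-1 : k) ^ (j + 1) * (((i j : k) - 1) * ((i (j + 1) : k) - 1)
                / ((i j : k) + (i (j + 1) : k) - 1))) •
              U3.v k 0 • U3.br k n (U3.merge i j (i j + i (j + 1)))) ∧
    -- chains `[i_1|…|i_{n-1}|1|0]` with `n ≥ 2` and `i_1, …, i_{n-1} ≥ 2`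
    (∀ (n : ℕ) (i : ℕ → ℕ), 2 ≤ n → (∀ j, 1 ≤ j → j ≤ n - 1 → 2 ≤ i j) →
      i n = 1 → i (n + 1) = 0 →
      Anick.IsChainTuple U3.obstructions (U3.tuple (n + 1) i) ∧
      U3.delta k n (U3.br k (n + 1) i) =
        U3.v k (i 1) • U3.br k n (fun t => i (t + 1))
        + ∑ j ∈ Finset.Icc 1 (n - 2),
            ((-1 : k) ^ j * ((i j : k) * (i (j + 1) : k) / ((i j : k) + (i (j + 1) : k) - 1))) •
              U3.v k 1 • U3.br k n (U3.merge i j (i j + i (j + 1) - 1))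
        + ∑ j ∈ Finset.Icc 1 (n - 2),
            ((-1 : k) ^ (j + 1) * (((i j : k) - 1) * ((i (j + 1) : k) - 1)
                / ((i j : k) + (i (j + 1) : k) - 1))) •
              U3.v k 0 • U3.br k n (U3.merge i j (i j + i (j + 1)))
        + ∑ j ∈ Finset.Icc 1 (n - 2),
            ((-1 : k) ^ j * ((i j : k) * ((i j : k) - 1) / ((i j : k) + (i (j + 1) : k) - 1))) •
              U3.br k n (U3.merge i j (i j + i (j + 1) - 1))
        + ∑ j ∈ Finset.Icc 2 (n - 2), ∑ t ∈ Finset.Icc 1 (j - 1),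
            ((-1 : k) ^ (j + 1) * (i t : k)
                * (((i j : k) - 1) * ((i (j + 1) : k) - 1)
                    / ((i j : k) + (i (j + 1) : k) - 1))) •
              U3.br k n (U3.merge (U3.dec i t) j (i j + i (j + 1)))
        + ∑ j ∈ Finset.Icc 2 (n - 2), ∑ t ∈ Finset.Icc 1 (j - 1),
            ((-1 : k) ^ j * ((i t : k) - 1)
                * ((i j : k) * (i (j + 1) : k) / ((i j : k) + (i (j + 1) : k) - 1))) •
              U3.br k n (U3.merge i j (i j + i (j + 1) - 1))
        + ∑ j ∈ Finset.Icc 1 (n - 1),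
            ((-1 : k) ^ n * (i j : k)) • U3.br k n (U3.merge (U3.dec i j) n 1)
        + ∑ j ∈ Finset.Icc 1 (n - 1),
            ((-1 : k) ^ (n - 1) * ((i j : k) - 1)) • U3.br k n (U3.merge i n 0)
        + ((-1 : k) ^ (n - 1)) • U3.v k 1 • U3.br k n (U3.merge i n 0)
        + ((-1 : k) ^ n) • U3.br k n (U3.merge i n 0)
        + ((-1 : k) ^ n) • U3.v k 0 • U3.br k n (U3.merge i n 1)) ∧
    -- the chain `[1|0]`
    (∀ i : ℕ → ℕ, i 1 = 1 → i 2 = 0 →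
      Anick.IsChainTuple U3.obstructions (U3.tuple 2 i) ∧
      U3.delta k 1 (U3.br k 2 i) =
        U3.v k 1 • U3.br k 1 (fun _ => 0) - U3.v k 0 • U3.br k 1 (fun _ => 1)
          - U3.br k 1 (fun _ => 0)) := by
  have H := U3.reducesBy_v k
  refine ⟨⟨U3.linearIndependent_reduced k, U3.redSpan_eq_top⟩,
    fun n c => U3.isEventualValue_anickDifferential H c, fun n c => U3.exists_tuple_of_chain c,
    fun n i hi => ⟨?_, U3.anickDifferential_regular H n i hi⟩,
    fun n i hn hi h1 h0 => ⟨?_, U3.anickDifferential_one_zero H n i hn hi h1 h0⟩,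
    fun i h1 h0 => ⟨?_, ?_⟩⟩
  · rw [U3.tuple_eq_letters, U3.isChainTuple_letters]
    exact U3.isChain_regular hi
  · rw [U3.tuple_eq_letters, U3.isChainTuple_letters]
    obtain ⟨n, rfl⟩ : ∃ m, n = m + 1 := ⟨n - 1, by omega⟩
    exact U3.isChain_one_zero hi h1 h0
  · rw [U3.tuple_eq_letters, U3.isChainTuple_letters]
    exact U3.isChain_one_zero (n := 0) (fun j h h' => by omega) h1 h0
  · exact U3.anickDifferential_bracket
      (U3.isChain_one_zero (n := 0) (fun j h h' => by omega) h1 h0) (U3.ev_one_zero_pair H h1 h0)
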